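/- Let $\mathcal C$ be a symmetric monoidal abelian category with unit $I$ and symmetry $\psi$ (associativity and unit constraints are suppressed below, $A^n$ denotes $A^{\otimes n}$ with $A^0=I$, $1$ denotes identities and $(f,g)=f\otimes g$). Let $(H,m,\eta,\Delta,\varepsilon,S)$ be a Hopf algebra in $\mathcal C$ and let $(\delta,\sigma)$ be a braided modular pair in involution (MPI) for $H$: $\delta:H\to I$ is an algebra map, $\sigma:I\to H$ is a coalgebra map, $\delta\sigma=\mathrm{id}_I$, and $m(m\otimes 1)(S\sigma\otimes\widetilde S^2\otimes\sigma)=\mathrm{id}_H$, where $\widetilde S=(\delta\otimes S)\Delta$. *The cocyclic object of a triple.* For a left $H$-module coalgebra $C$ with action $\phi_C$ (a coalgebra with a left $H$-action that is a coalgebra map $H\otimes C\to C$), and an object $M$ with a right $H$-action $\phi_M:M\otimes H\to M$ and a left $H$-coaction $\rho_M:M\to H\otimes M$ making it a stable anti-Yetter–Drinfeld (SAYD) module, i.e. $\phi_M\psi_{H,M}\rho_M=1_M$ and $$\rho_M\phi_M=(m(S\otimes m)\otimes\phi_M)(\psi_{H^2,H}\otimes 1_M\otimes 1_H)(1_{H^2}\otimes\psi_{M,H}\otimes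 1_H)(1_{H^2}\otimes 1_M\otimes\psi_{H,H})(1_H\otimes\psi_{M,H}\otimes1_{H^2})(\rho_M\otimes\Delta^2),$$ put on the objects $M\otimes C^{n+1}$, $n\ge 0$, $$\delta_i=(1_M,1_{C^i},\Delta_C,1_{C^{n-i-1}})\ (0\le i<n),\qquad \delta_n=(1_M,\psi_{C,C^n})(1_M,\phi_C,1_{C^n})(\psi_{H,M},1_{C^{n+1}})(\rho_M,\Delta_C,1_{C^{n-1}})$$ as maps from degree $n-1$ to degree $n$, $\sigma_i=(1_M,1_{C^{i+1}},\varepsilon_C,1_{C^{n-i}})$ $(0\le i\le n)$ from degree $n+1$ to degree $n$, and $\tau_n=(1_M,\psi_{C,C^n})(1_M,\phi_C,1_{C^n})(\psi_{H,M},1_{C^{n+1}})(\rho_M,1_{C^{n+1}})$. The associated cocyclic object has objects $M\otimes_H C^{n+1}=\mathrm{coker}(\phi_M\otimes 1-1\otimes\phi_{C^{n+1}}:M\otimes H\otimes C^{n+1}\to M\otimes C^{n+1})$, where $\phi_{C^{n+1}}$ is the diagonal action (comultiply $H$ into $n+1$ factors and let each act on one factor $C$), and the induced maps $\widetilde\delta_i,\widetilde\sigma_i,\widetilde\tau_n$.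 **Theorem.** The coalgebra $H$ with the left action $m$ is a left $H$-module coalgebra, and ${}^{\sigma}I_\delta$, i.e. $I$ with the right action $\delta:I\otimes H=H\to I$ and the left coaction $\sigma:I\to H=H\otimes I$, is a SAYD module. For $C=H$ and $M={}^\sigma I_\delta$ the above maps descend to the objects ${}^\sigma I_\delta\otimes_H H^{n+1}$ and make them a cocyclic object in $\mathcal C$, and this cocyclic object is isomorphic to the following one (which is therefore also a cocyclic object): $C^0(H)=I$, $C^n(H)=H^n$ for $n\ge1$, with faces $\delta_i:H^{n-1}\to H^n$ $(n\ge 1)$ $$\delta_0=(\eta,1,\dots,1),\qquad \delta_i=(1,\dots,1,\underset{i\text{-th}}{\Delta},1,\dots,1)\ (1\le i\le n-1),\qquad \delta_n=(1,\dots,1,\sigma),$$ degeneracies $\sigma_i=(1,\dots,1,\underset{(i+1)\text{-th}}{\varepsilon},1,\dots,1):H^{n+1}\to H^n$ $(0\le i\le n)$, and cyclic maps $$\tau_0=\mathrm{id}_I,\qquad \tau_n=m_n\,(\Delta^{n-1}\widetilde S,\,1_{H^{n-1}},\,\sigma)\quad(n\ge1).$$ Here $\Delta^{n-1}:H\to H^{n}$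 is the iterated comultiplication, $m_1=m$, and for $n\ge2$, $m_n=(m,\dots,m)\,\mathcal F_n(\psi):H^n\otimes H^n\to H^n$ with $\mathcal F_n(\psi)=\prod_{j=1}^{n-1}(1_{H^j},\underbrace{\psi_{H,H},\dots,\psi_{H,H}}_{n-j},1_{H^j})$, the factor with $j=n-1$ being applied first (so $m_n$ is the multiplication of the tensor power algebra $H^{n}$). -/

import Mathlib

open CategoryTheory MonoidalCategory Limits
open scoped MonObj ComonObj HopfObj

universe v u

namespace BraidedHopfCyclic

noncomputable section

/-! ### Cocyclic objects -/

/-- The data underlying a cocyclic object: objects `X n`, cofaces `δ_i : X n ⟶ X (n+1)`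
(`0 ≤ i ≤ n+1`), codegeneracies `σ_i : X (n+1) ⟶ X n` (`0 ≤ i ≤ n`) and cyclic operators
`τ_n : X n ⟶ X n`. -/
structure CocyclicData (C : Type u) [Category.{v} C] where
  X : ℕ → C
  δ : ∀ n : ℕ, Fin (n + 2) → (X n ⟶ X (n + 1))
  σ : ∀ n : ℕ, Fin (n + 1) → (X (n + 1) ⟶ X n)
  τ : ∀ n : ℕ, X n ⟶ X n

/-- The axioms of a cocyclic object (the cosimplicial identities, the relations between the cyclic
operators and the cofaces and codegeneracies, and `τ_n ^ (n+1) = id`). -/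
structure CocyclicData.IsCocyclic {C : Type u} [Category.{v} C] (D : CocyclicData C) : Prop where
  δ_comp_δ : ∀ (n : ℕ) (i j : Fin (n + 2)), i ≤ j →
    D.δ n i ≫ D.δ (n + 1) j.succ = D.δ n j ≫ D.δ (n + 1) i.castSucc
  σ_comp_σ : ∀ (n : ℕ) (i j : Fin (n + 1)), i ≤ j →
    D.σ (n + 1) i.castSucc ≫ D.σ n j = D.σ (n + 1) j.succ ≫ D.σ n i
  δ_comp_σ_of_le : ∀ (n : ℕ) (i : Fin (n + 2)) (j : Fin (n + 1)), i ≤ j.castSucc →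
    D.δ (n + 1) i.castSucc ≫ D.σ (n + 1) j.succ = D.σ n j ≫ D.δ n i
  δ_comp_σ_self : ∀ (n : ℕ) (i : Fin (n + 1)), D.δ n i.castSucc ≫ D.σ n i = 𝟙 (D.X n)
  δ_comp_σ_succ : ∀ (n : ℕ) (i : Fin (n + 1)), D.δ n i.succ ≫ D.σ n i = 𝟙 (D.X n)
  δ_comp_σ_of_gt : ∀ (n : ℕ) (i : Fin (n + 2)) (j : Fin (n + 1)), j.castSucc < i →
    D.δ (n + 1) i.succ ≫ D.σ (n + 1) j.castSucc = D.σ n j ≫ D.δ n i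
  δ_succ_comp_τ : ∀ (n : ℕ) (i : Fin (n + 1)),
    D.δ n i.succ ≫ D.τ (n + 1) = D.τ n ≫ D.δ n i.castSucc
  δ_zero_comp_τ : ∀ n : ℕ, D.δ n 0 ≫ D.τ (n + 1) = D.δ n (Fin.last (n + 1))
  σ_succ_comp_τ : ∀ (n : ℕ) (i : Fin n),
    D.σ n i.succ ≫ D.τ n = D.τ (n + 1) ≫ D.σ n i.castSucc
  σ_zero_comp_τ : ∀ n : ℕ,
    D.σ n 0 ≫ D.τ n = D.τ (n + 1) ≫ D.τ (n + 1) ≫ D.σ n (Fin.last n)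
  τ_pow : ∀ n : ℕ, (show End (D.X n) from D.τ n) ^ (n + 1) = 1

/-- Isomorphisms: degreewise isomorphisms commuting with all structure maps. -/
structure CocyclicData.Iso {C : Type u} [Category.{v} C] (D E : CocyclicData C) where
  iso : ∀ n : ℕ, D.X n ≅ E.X n
  comm_δ : ∀ (n : ℕ) (i : Fin (n + 2)), D.δ n i ≫ (iso (n + 1)).hom = (iso n).hom ≫ E.δ n i
  comm_σ : ∀ (n : ℕ) (i : Fin (n + 1)), D.σ n i ≫ (iso n).hom = (iso (n + 1)).hom ≫ E.σ n i
  comm_τ : ∀ n : ℕ, D.τ n ≫ (iso n).hom = (iso n).hom ≫ E.τ n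

section Monoidal

variable {C : Type u} [Category.{v} C] [MonoidalCategory C]

/-! ### Tensor powers -/

/-- The tensor power `A^{⊗ n}`, with `A^{⊗ 0} = 𝟙_ C` and `A^{⊗ (n+1)} = A ⊗ A^{⊗ n}`. -/
def pow (A : C) : ℕ → C
  | 0 => 𝟙_ C
  | n + 1 => A ⊗ pow A n

/-- `f^{⊗ n} : A^{⊗ n} ⟶ B^{⊗ n}`. -/
def powMap {A B : C} (f : A ⟶ B) : (n : ℕ) → (pow A n ⟶ pow B n)
  | 0 => 𝟙 (𝟙_ C)
  | n + 1 => f ⊗ₘ powMap f n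

/-- The coherence isomorphism `A^{⊗ n} ⊗ A ≅ A^{⊗ (n+1)}`. -/
def powSnoc (A : C) : (n : ℕ) → (pow A n ⊗ A ≅ pow A (n + 1))
  | 0 => λ_ A ≪≫ (ρ_ A).symm
  | n + 1 => α_ A (pow A n) A ≪≫ whiskerLeftIso A (powSnoc A n)

/-- `(1, …, 1, Δ, 1, …, 1) : A^{⊗ n} ⟶ A^{⊗ (n+1)}`, the comultiplication applied to the factor
number `i` (counted from `0`). -/
def comulAt (A : C) [ComonObj A] : (n : ℕ) → Fin n → (pow A n ⟶ pow A (n + 1))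
  | 0 => fun i => i.elim0
  | n + 1 => Fin.cases (Δ[A] ▷ pow A n ≫ (α_ A A (pow A n)).hom) (fun i => A ◁ comulAt A n i)

/-- `(1, …, 1, ε, 1, …, 1) : A^{⊗ (n+1)} ⟶ A^{⊗ n}`, the counit applied to the factor
number `i` (counted from `0`). -/
def counitAt (A : C) [ComonObj A] : (n : ℕ) → Fin (n + 1) → (pow A (n + 1) ⟶ pow A n)
  | 0 => fun _ => ε[A] ▷ 𝟙_ C ≫ (λ_ (𝟙_ C)).hom
  | n + 1 => Fin.cases (ε[A] ▷ pow A (n + 1) ≫ (λ_ (pow A (n + 1))).hom)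
      (fun i => A ◁ counitAt A n i)

/-- The iterated comultiplication `Δ^n : A ⟶ A^{⊗ (n+1)}`, with `Δ^0 = id`. -/
def comulPow (A : C) [ComonObj A] : (n : ℕ) → (A ⟶ pow A (n + 1))
  | 0 => (ρ_ A).inv
  | n + 1 => Δ[A] ≫ A ◁ comulPow A n

/-- The braid `A^{⊗ n} ⊗ B^{⊗ n} ⟶ (A ⊗ B)^{⊗ n}` sending `a₁ ⊗ ⋯ ⊗ aₙ ⊗ b₁ ⊗ ⋯ ⊗ bₙ` to
`a₁ ⊗ b₁ ⊗ ⋯ ⊗ aₙ ⊗ bₙ`, in which every `b_i` is moved by the braiding `ψ_{A,B}` past all the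
`a_j` with `j > i`; for `n = 2` it is `1 ⊗ ψ_{A,B} ⊗ 1`. -/
def interleave [BraidedCategory C] (A B : C) :
    (n : ℕ) → (pow A n ⊗ pow B n ⟶ pow (A ⊗ B) n)
  | 0 => (λ_ (𝟙_ C)).hom
  | n + 1 => tensorμ A (pow A n) B (pow B n) ≫ (A ⊗ B) ◁ interleave A B n

/-- The multiplication `m_n = (m, …, m) ∘ F_n(ψ)` of the algebra `A^{⊗ n}`. -/
def mulPow [BraidedCategory C] (A : C) [MonObj A] (n : ℕ) : pow A n ⊗ pow A n ⟶ pow A n :=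
  interleave A A n ≫ powMap μ[A] n

/-! ### Modules and comodules -/

/-- A right module structure over the algebra `H` on the object `M`. -/
structure RightModule (H : C) [MonObj H] (M : C) where
  act : M ⊗ H ⟶ M
  act_one : M ◁ η[H] ≫ act = (ρ_ M).hom
  act_mul : M ◁ μ[H] ≫ act = (α_ M H H).inv ≫ act ▷ H ≫ act

/-- A left comodule structure over the coalgebra `H` on the object `M`. -/
structure LeftComodule (H : C) [ComonObj H] (M : C) where
  coact : M ⟶ H ⊗ M
  counit_coact : coact ≫ ε[H] ▷ M = (λ_ M).inv
  comul_coact : coact ≫ Δ[H] ▷ M = coact ≫ H ◁ coact ≫ (α_ H H M).inv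

/-- The action map `H ⊗ K ⟶ K` of a left `H`-module structure on `K`. -/
def leftAct {H K : C} [MonObj H] (b : ModObj H K) : H ⊗ K ⟶ K := b.smul

variable [BraidedCategory C]

/-- The coalgebra `K` with the left `H`-action `b` is a left `H`-module coalgebra: the action is a
coalgebra map. -/
structure IsModuleCoalgebra {H K : C} [HopfObj H] [ComonObj K] (b : ModObj H K) : Prop where
  act_comul : leftAct b ≫ Δ[K] =
    (Δ[H] ⊗ₘ Δ[K]) ≫ tensorμ H H K K ≫ (leftAct b ⊗ₘ leftAct b)
  act_counit : leftAct b ≫ ε[K] = (ε[H] ⊗ₘ ε[K]) ≫ (λ_ (𝟙_ C)).hom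

/-- `M` with the given right action and left coaction is a right-left braided stable
anti-Yetter–Drinfeld module over `H`. The composite in the first condition is, read from left to
right, `m ⊗ h ↦ m₋₁ ⊗ m₀ ⊗ h₁ ⊗ h₂ ⊗ h₃ ↦ m₋₁ ⊗ h₁ ⊗ m₀ ⊗ h₂ ⊗ h₃ ↦ m₋₁ ⊗ h₁ ⊗ m₀ ⊗ h₃ ⊗ h₂
↦ m₋₁ ⊗ h₁ ⊗ h₃ ⊗ m₀ ⊗ h₂ ↦ h₃ ⊗ m₋₁ ⊗ h₁ ⊗ m₀ ⊗ h₂ ↦ S(h₃) (m₋₁ h₁) ⊗ m₀ h₂`. -/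
structure IsSAYD {H M : C} [HopfObj H] (a : RightModule H M) (c : LeftComodule H M) : Prop where
  ayd : a.act ≫ c.coact =
    (c.coact ⊗ₘ (Δ[H] ≫ H ◁ Δ[H])) ⊗≫
    (H ◁ (β_ M H).hom ▷ (H ⊗ H)) ⊗≫
    ((H ⊗ H ⊗ M) ◁ (β_ H H).hom) ⊗≫
    ((H ⊗ H) ◁ (β_ M H).hom ▷ H) ⊗≫
    ((β_ (H ⊗ H) H).hom ▷ (M ⊗ H)) ⊗≫
    (((𝒮[H] ⊗ₘ μ[H]) ≫ μ[H]) ⊗ₘ a.act)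
  stable : c.coact ≫ (β_ H M).hom ≫ a.act = 𝟙 M

/-! ### The para-cocyclic object of a triple `(H, K, M)` -/

/-- The diagonal action `H ⊗ K^{⊗ (n+1)} ⟶ K^{⊗ (n+1)}`,
`(φ_K, …, φ_K) ∘ F(ψ_{H,K}) ∘ (Δ^n ⊗ 1)`. -/
def diagAct {H K : C} [HopfObj H] (b : ModObj H K) (n : ℕ) :
    H ⊗ pow K (n + 1) ⟶ pow K (n + 1) :=
  comulPow H n ▷ pow K (n + 1) ≫ interleave H K (n + 1) ≫ powMap (leftAct b) (n + 1)

/-- The composite `(1_M, ψ_{K, K^n}) (1_M, φ_K, 1_{K^n}) (ψ_{H,M}, 1_{K^{n+1}})`, that is,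
`h ⊗ m ⊗ k₀ ⊗ k₁ ⊗ ⋯ ⊗ kₙ ↦ m ⊗ k₁ ⊗ ⋯ ⊗ kₙ ⊗ h k₀`. -/
def rotate {H K : C} [HopfObj H] (b : ModObj H K) (M : C) (n : ℕ) :
    (H ⊗ M) ⊗ pow K (n + 1) ⟶ M ⊗ pow K (n + 1) :=
  (β_ H M).hom ▷ (K ⊗ pow K n) ≫ (α_ M H (K ⊗ pow K n)).hom ≫
    M ◁ ((α_ H K (pow K n)).inv ≫ leftAct b ▷ pow K n ≫
      (β_ K (pow K n)).hom ≫ (powSnoc K n).hom)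

/-- The structure maps on `C^n(K, M) = M ⊗ K^{⊗ (n+1)}`. -/
def tripleData {H K M : C} [HopfObj H] [ComonObj K] (b : ModObj H K)
    (c : LeftComodule H M) : CocyclicData C where
  X n := M ⊗ pow K (n + 1)
  δ n := Fin.lastCases
    ((c.coact ⊗ₘ comulAt K (n + 1) 0) ≫ rotate b M (n + 1))
    (fun i : Fin (n + 1) => M ◁ comulAt K (n + 1) i)
  σ n i := M ◁ counitAt K (n + 1) i.succ
  τ n := c.coact ▷ pow K (n + 1) ≫ rotate b M n

end Monoidal

/-! ### The cocyclic object on the balanced tensor products -/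

section Abelian

variable {C : Type u} [Category.{v} C] [Abelian C] [MonoidalCategory C] [BraidedCategory C]

/-- The map `φ_M ⊗ 1 - 1 ⊗ φ_{K^{n+1}} : M ⊗ H ⊗ K^{⊗ (n+1)} ⟶ M ⊗ K^{⊗ (n+1)}`. -/
def balancedMap {H K M : C} [HopfObj H] (b : ModObj H K) (a : RightModule H M) (n : ℕ) :
    (M ⊗ H) ⊗ pow K (n + 1) ⟶ M ⊗ pow K (n + 1) :=
  a.act ▷ pow K (n + 1) - (α_ M H (pow K (n + 1))).hom ≫ M ◁ diagAct b n

/-- The balanced tensor product `M ⊗_H K^{⊗ (n+1)}`. -/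
def balanced {H K M : C} [HopfObj H] (b : ModObj H K) (a : RightModule H M) (n : ℕ) : C :=
  cokernel (balancedMap b a n)

/-- The projection `M ⊗ K^{⊗ (n+1)} ⟶ M ⊗_H K^{⊗ (n+1)}`. -/
def balancedProj {H K M : C} [HopfObj H] (b : ModObj H K) (a : RightModule H M) (n : ℕ) :
    M ⊗ pow K (n + 1) ⟶ balanced b a n :=
  cokernel.π (balancedMap b a n)

/-- The faces, degeneracies and cyclic maps on the objects `M ⊗_H K^{⊗ (n+1)}` induced by those on
`M ⊗ K^{⊗ (n+1)}`. They are unique as soon as they exist, the projections being epimorphisms. -/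
structure InducedMaps {H K M : C} [HopfObj H] [ComonObj K] (b : ModObj H K)
    (a : RightModule H M) (c : LeftComodule H M) where
  δ : ∀ n : ℕ, Fin (n + 2) → (balanced b a n ⟶ balanced b a (n + 1))
  σ : ∀ n : ℕ, Fin (n + 1) → (balanced b a (n + 1) ⟶ balanced b a n)
  τ : ∀ n : ℕ, balanced b a n ⟶ balanced b a n
  proj_δ : ∀ (n : ℕ) (i : Fin (n + 2)),
    balancedProj b a n ≫ δ n i = (tripleData b c).δ n i ≫ balancedProj b a (n + 1)
  proj_σ : ∀ (n : ℕ) (i : Fin (n + 1)),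
    balancedProj b a (n + 1) ≫ σ n i = (tripleData b c).σ n i ≫ balancedProj b a n
  proj_τ : ∀ n : ℕ, balancedProj b a n ≫ τ n = (tripleData b c).τ n ≫ balancedProj b a n

/-- The objects `M ⊗_H K^{⊗ (n+1)}` with the induced maps. -/
def InducedMaps.toCocyclicData {H K M : C} [HopfObj H] [ComonObj K] {b : ModObj H K}
    {a : RightModule H M} {c : LeftComodule H M} (T : InducedMaps b a c) : CocyclicData C where
  X n := balanced b a n
  δ := T.δ
  σ := T.σ
  τ := T.τ

end Abelian

/-! ### Modular pairs in involution and the module `^σI_δ` -/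

section ModularPair

variable {C : Type u} [Category.{v} C] [MonoidalCategory C] [BraidedCategory C]
  {H : C} [HopfObj H]

/-- Characters: algebra maps `δ : H ⟶ 𝟙_ C`. -/
structure IsCharacter (δ : H ⟶ 𝟙_ C) : Prop where
  mul : μ[H] ≫ δ = (δ ⊗ₘ δ) ≫ (λ_ (𝟙_ C)).hom
  one : η[H] ≫ δ = 𝟙 (𝟙_ C)

/-- Co-characters: coalgebra maps `σ : 𝟙_ C ⟶ H`. -/
structure IsCocharacter (σ : 𝟙_ C ⟶ H) : Prop where
  comul : σ ≫ Δ[H] = (λ_ (𝟙_ C)).inv ≫ (σ ⊗ₘ σ)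
  counit : σ ≫ ε[H] = 𝟙 (𝟙_ C)

/-- The `δ`-twisted antipode `S̃ = (δ ⊗ S) Δ`. -/
def twistedAntipode (δ : H ⟶ 𝟙_ C) : H ⟶ H :=
  Δ[H] ≫ (δ ⊗ₘ 𝒮[H]) ≫ (λ_ H).hom

/-- `(δ, σ)` is a braided modular pair in involution: `δ` is a character, `σ` a co-character,
`δ σ = id` and `m (m ⊗ id) (S σ ⊗ S̃² ⊗ σ) = id`. -/
structure IsBraidedMPI (δ : H ⟶ 𝟙_ C) (σ : 𝟙_ C ⟶ H) : Prop where
  character : IsCharacter δ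
  cocharacter : IsCocharacter σ
  modular : σ ≫ δ = 𝟙 (𝟙_ C)
  involution : (λ_ H).inv ≫ (ρ_ (𝟙_ C ⊗ H)).inv ≫
    (((σ ≫ 𝒮[H]) ⊗ₘ (twistedAntipode δ ≫ twistedAntipode δ)) ⊗ₘ σ) ≫
    μ[H] ▷ H ≫ μ[H] = 𝟙 H

/-- The unit object as a right `H`-module through a character. -/
def characterModule {δ : H ⟶ 𝟙_ C} (hδ : IsCharacter δ) : RightModule H (𝟙_ C) where
  act := (λ_ H).hom ≫ δ
  act_one := by
    rw [← Category.assoc, leftUnitor_naturality, Category.assoc, hδ.one]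
    simp [unitors_equal]
  act_mul := by
    rw [← Category.assoc, leftUnitor_naturality, Category.assoc, hδ.mul]
    simp [MonoidalCategory.tensorHom_def]

/-- The unit object as a left `H`-comodule through a co-character. -/
def cocharacterComodule {σ : 𝟙_ C ⟶ H} (hσ : IsCocharacter σ) : LeftComodule H (𝟙_ C) where
  coact := σ ≫ (ρ_ H).inv
  counit_coact := by
    rw [Category.assoc, ← rightUnitor_inv_naturality, ← Category.assoc, hσ.counit]
    simp [unitors_inv_equal]
  comul_coact := by
    rw [Category.assoc, ← rightUnitor_inv_naturality, ← Category.assoc, hσ.comul]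
    simp [MonoidalCategory.tensorHom_def, unitors_inv_equal]

/-! ### The braided Connes–Moscovici cocyclic object -/

/-- The map `(1, …, 1, σ) : H^{⊗ n} ⟶ H^{⊗ (n+1)}`. -/
def snocMap (σ : 𝟙_ C ⟶ H) (n : ℕ) : pow H n ⟶ pow H (n + 1) :=
  (ρ_ (pow H n)).inv ≫ pow H n ◁ σ ≫ (powSnoc H n).hom

/-- The map `(η, 1, …, 1) : H^{⊗ n} ⟶ H^{⊗ (n+1)}`. -/
def consUnit (H : C) [HopfObj H] (n : ℕ) : pow H n ⟶ pow H (n + 1) :=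
  (λ_ (pow H n)).inv ≫ η[H] ▷ pow H n

/-- The cyclic map: `τ_0 = id` and `τ_n = m_n (Δ^{n-1} S̃, 1_{H^{n-1}}, σ)` for `n ≥ 1`. -/
def cmTau (δ : H ⟶ 𝟙_ C) (σ : 𝟙_ C ⟶ H) : (n : ℕ) → (pow H n ⟶ pow H n)
  | 0 => 𝟙 (𝟙_ C)
  | n + 1 => ((twistedAntipode δ ≫ comulPow H n) ⊗ₘ snocMap σ n) ≫ mulPow H (n + 1)

/-- The braided Connes–Moscovici data on the objects `H^{⊗ n}`: the coface `δ_0` is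
`(η, 1, …, 1)`, the last one is `(1, …, 1, σ)`, and the inner ones apply `Δ` to the `i`-th factor;
the codegeneracy `σ_i` applies `ε` to the `(i+1)`-st factor. -/
def cmData (δ : H ⟶ 𝟙_ C) (σ : 𝟙_ C ⟶ H) : CocyclicData C where
  X n := pow H n
  δ n := Fin.cases (consUnit H n)
    (fun j : Fin (n + 1) => Fin.lastCases (snocMap σ n) (fun k : Fin n => comulAt H n k) j)
  σ n i := counitAt H n i
  τ n := cmTau δ σ n

end ModularPair

end

end BraidedHopfCyclic

/-!
With trivial coefficients `^σI_δ` the balanced tensor product is the quotient of `H^{⊗ (n+1)}` by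
the relations `h · x = δ(h) x` for the diagonal action. Since `h a ⊗ x = h₁ a ⊗ h₂ S(h₃) x`, the
relations give `h a ⊗ x ~ a ⊗ S̃(h) x`, so `h ⊗ x ↦ S̃(h) x` identifies the quotient with `H^{⊗ n}`,
and `x ↦ 1 ⊗ x` is the inverse.

Before taking quotients, the structure maps are those of the coalgebra `H`, with the cyclic rotation
twisted by `L = σ · -`. For every coalgebra endomorphism `L` they satisfy all axioms of a cocyclic
object but one: instead of the identity, `τ_n ^ (n+1)` is `L^{⊗ (n+1)}`. For `L = σ · -` this is the
diagonal action of the grouplike element `σ`, which is trivial on the quotient as `δ σ = 1`.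

The involution condition gives `S̃(h₂) σ h₁ = δ(h) σ`, which makes the rotation
compatible with the quotient and is also the anti-Yetter–Drinfeld condition for `^σI_δ`.
-/

namespace BraidedHopfCyclic

noncomputable section

section Cocyclic

variable {C : Type u} [Category.{v} C]

/-- The `n`-th iterate of an endomorphism: the power in the monoid `End X`, seen as a morphism. -/
def endPow {X : C} (f : X ⟶ X) (n : ℕ) : X ⟶ X := (End.of f ^ n : End X)

theorem endPow_zero {X : C} (f : X ⟶ X) : endPow f 0 = 𝟙 X := rfl

theorem endPow_succ {X : C} (f : X ⟶ X) (n : ℕ) : endPow f (n + 1) = f ≫ endPow f n :=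
  pow_succ (End.of f) n

theorem endPow_comp {X Y : C} {p : X ⟶ Y} {f : X ⟶ X} {g : Y ⟶ Y} (h : f ≫ p = p ≫ g) (n : ℕ) :
    endPow f n ≫ p = p ≫ endPow g n := by
  induction n with
  | zero => rw [endPow_zero, endPow_zero, Category.id_comp, Category.comp_id]
  | succ n ih => rw [endPow_succ, endPow_succ, Category.assoc, ih, reassoc_of% h]

namespace CocyclicData

/-- The axioms of a cocyclic object except `τ_n ^ (n+1) = id`. -/
structure IsParacocyclic (D : CocyclicData C) : Prop where
  δ_comp_δ : ∀ (n : ℕ) (i j : Fin (n + 2)), i ≤ j →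
    D.δ n i ≫ D.δ (n + 1) j.succ = D.δ n j ≫ D.δ (n + 1) i.castSucc
  σ_comp_σ : ∀ (n : ℕ) (i j : Fin (n + 1)), i ≤ j →
    D.σ (n + 1) i.castSucc ≫ D.σ n j = D.σ (n + 1) j.succ ≫ D.σ n i
  δ_comp_σ_of_le : ∀ (n : ℕ) (i : Fin (n + 2)) (j : Fin (n + 1)), i ≤ j.castSucc →
    D.δ (n + 1) i.castSucc ≫ D.σ (n + 1) j.succ = D.σ n j ≫ D.δ n i
  δ_comp_σ_self : ∀ (n : ℕ) (i : Fin (n + 1)), D.δ n i.castSucc ≫ D.σ n i = 𝟙 (D.X n)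
  δ_comp_σ_succ : ∀ (n : ℕ) (i : Fin (n + 1)), D.δ n i.succ ≫ D.σ n i = 𝟙 (D.X n)
  δ_comp_σ_of_gt : ∀ (n : ℕ) (i : Fin (n + 2)) (j : Fin (n + 1)), j.castSucc < i →
    D.δ (n + 1) i.succ ≫ D.σ (n + 1) j.castSucc = D.σ n j ≫ D.δ n i
  δ_succ_comp_τ : ∀ (n : ℕ) (i : Fin (n + 1)),
    D.δ n i.succ ≫ D.τ (n + 1) = D.τ n ≫ D.δ n i.castSucc
  δ_zero_comp_τ : ∀ n : ℕ, D.δ n 0 ≫ D.τ (n + 1) = D.δ n (Fin.last (n + 1))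
  σ_succ_comp_τ : ∀ (n : ℕ) (i : Fin n),
    D.σ n i.succ ≫ D.τ n = D.τ (n + 1) ≫ D.σ n i.castSucc
  σ_zero_comp_τ : ∀ n : ℕ,
    D.σ n 0 ≫ D.τ n = D.τ (n + 1) ≫ D.τ (n + 1) ≫ D.σ n (Fin.last n)

/-- A morphism of cocyclic data: a family of morphisms commuting with all structure maps. -/
structure Hom (D E : CocyclicData C) where
  app : ∀ n : ℕ, D.X n ⟶ E.X n
  app_comp_δ : ∀ (n : ℕ) (i : Fin (n + 2)), app n ≫ E.δ n i = D.δ n i ≫ app (n + 1)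
  app_comp_σ : ∀ (n : ℕ) (i : Fin (n + 1)), app (n + 1) ≫ E.σ n i = D.σ n i ≫ app n
  app_comp_τ : ∀ n : ℕ, app n ≫ E.τ n = D.τ n ≫ app n

variable {D E : CocyclicData C}

theorem IsParacocyclic.of_epi (h : D.IsParacocyclic) (p : D.Hom E) [∀ n, Epi (p.app n)] :
    E.IsParacocyclic := by
  have hδ := @p.app_comp_δ
  have hσ := @p.app_comp_σ
  have hτ := @p.app_comp_τ
  constructor <;> intros <;> rw [← cancel_epi (p.app _)]
  · simp only [reassoc_of% hδ, hδ, reassoc_of% h.δ_comp_δ _ _ _ ‹_›]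
  · simp only [reassoc_of% hσ, hσ, reassoc_of% h.σ_comp_σ _ _ _ ‹_›]
  · simp only [reassoc_of% hσ, hσ, reassoc_of% hδ, hδ, reassoc_of% h.δ_comp_σ_of_le _ _ _ ‹_›]
  · simp only [hσ, reassoc_of% hδ, reassoc_of% h.δ_comp_σ_self, Category.comp_id]
  · simp only [hσ, reassoc_of% hδ, reassoc_of% h.δ_comp_σ_succ, Category.comp_id]
  · simp only [reassoc_of% hσ, hσ, reassoc_of% hδ, hδ, reassoc_of% h.δ_comp_σ_of_gt _ _ _ ‹_›]
  · simp only [reassoc_of% hτ, hτ, reassoc_of% hδ, hδ, reassoc_of% h.δ_succ_comp_τ]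
  · simp only [hτ, reassoc_of% hδ, hδ, reassoc_of% h.δ_zero_comp_τ]
  · simp only [reassoc_of% hτ, hτ, reassoc_of% hσ, hσ, reassoc_of% h.σ_succ_comp_τ]
  · simp only [reassoc_of% hτ, hτ, reassoc_of% hσ, hσ, reassoc_of% h.σ_zero_comp_τ]

theorem IsParacocyclic.isCocyclic_of_epi (h : D.IsParacocyclic) (p : D.Hom E)
    [∀ n, Epi (p.app n)] (hτ : ∀ n, endPow (D.τ n) (n + 1) ≫ p.app n = p.app n) : E.IsCocyclic :=
  { h.of_epi p with
    τ_pow := fun n => by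
      rw [← cancel_epi (p.app n)]
      change p.app n ≫ endPow (E.τ n) (n + 1) = p.app n ≫ 𝟙 (E.X n)
      rw [← endPow_comp (p.app_comp_τ n).symm, hτ, Category.comp_id] }

/-- The inverse of an isomorphism of cocyclic data, as a morphism. -/
def Iso.inv (e : D.Iso E) : E.Hom D where
  app n := (e.iso n).inv
  app_comp_δ n i := by
    rw [Iso.inv_comp_eq, ← reassoc_of% e.comm_δ, Iso.hom_inv_id, Category.comp_id]
  app_comp_σ n i := by
    rw [Iso.inv_comp_eq, ← reassoc_of% e.comm_σ, Iso.hom_inv_id, Category.comp_id]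
  app_comp_τ n := by
    rw [Iso.inv_comp_eq, ← reassoc_of% e.comm_τ, Iso.hom_inv_id, Category.comp_id]

theorem Iso.isCocyclic (e : D.Iso E) (h : E.IsCocyclic) : D.IsCocyclic :=
  have (n : ℕ) : Epi (e.inv.app n) := inferInstanceAs (Epi (e.iso n).inv)
  have hE : E.IsParacocyclic := { h with }
  hE.isCocyclic_of_epi e.inv fun n =>
    (congrArg (· ≫ e.inv.app n) (h.τ_pow n)).trans (Category.id_comp _)

end CocyclicData

end Cocyclic

-- Without this, `simp` and `rw` do not see that `A^{⊗ (n+1)}` is `A ⊗ A^{⊗ n}`.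
attribute [reducible] pow

section Coalgebra

variable {C : Type u} [Category.{v} C] [MonoidalCategory C] (A : C)

theorem powSnoc_succ_hom (n : ℕ) :
    (powSnoc A (n + 1)).hom = (α_ A (pow A n) A).hom ≫ A ◁ (powSnoc A n).hom := rfl

variable [ComonObj A]

theorem comulAt_zero (n : ℕ) :
    comulAt A (n + 1) 0 = Δ[A] ▷ pow A n ≫ (α_ A A (pow A n)).hom := rfl

theorem comulAt_succ (n : ℕ) (i : Fin n) : comulAt A (n + 1) i.succ = A ◁ comulAt A n i := rfl

theorem counitAt_zero (n : ℕ) : counitAt A n 0 = ε[A] ▷ pow A n ≫ (λ_ (pow A n)).hom := by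
  cases n <;> rfl

theorem counitAt_succ (n : ℕ) (i : Fin (n + 1)) :
    counitAt A (n + 1) i.succ = A ◁ counitAt A n i := rfl

theorem whiskerLeft_comp_comulAt_zero {m n : ℕ} (f : pow A m ⟶ pow A n) :
    A ◁ f ≫ comulAt A (n + 1) 0 = comulAt A (m + 1) 0 ≫ A ◁ A ◁ f := by
  simp [comulAt_zero, whisker_exchange_assoc]

theorem whiskerLeft_comp_counitAt_zero {m n : ℕ} (f : pow A m ⟶ pow A n) :
    A ◁ f ≫ counitAt A n 0 = counitAt A m 0 ≫ f := by
  simp only [counitAt_zero, whisker_exchange_assoc, leftUnitor_naturality, Category.assoc]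

theorem comulAt_zero_comp_comulAt_one (n : ℕ) :
    comulAt A (n + 1) 0 ≫ comulAt A (n + 2) 1 = comulAt A (n + 1) 0 ≫ comulAt A (n + 2) 0 := by
  have h : Δ[A] ▷ pow A n ≫ (A ◁ Δ[A]) ▷ pow A n =
      Δ[A] ▷ pow A n ≫ (Δ[A] ▷ A ≫ (α_ A A A).hom) ▷ pow A n := by
    rw [← comp_whiskerRight, ComonObj.comul_assoc, comp_whiskerRight]
  rw [← Fin.succ_zero_eq_one, comulAt_succ]
  simpa [comulAt_zero] using h =≫ ((α_ A (A ⊗ A) (pow A n)).hom ≫ A ◁ (α_ A A (pow A n)).hom)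

theorem comulAt_zero_comp_counitAt_zero (n : ℕ) :
    comulAt A (n + 1) 0 ≫ counitAt A (n + 1) 0 = 𝟙 (pow A (n + 1)) := by
  have h : Δ[A] ▷ pow A n ≫ (ε[A] ▷ A) ▷ pow A n = (λ_ A).inv ▷ pow A n := by
    rw [← comp_whiskerRight, ComonObj.counit_comul]
  simpa [comulAt_zero, counitAt_zero] using
    h =≫ ((α_ (𝟙_ C) A (pow A n)).hom ≫ (λ_ (A ⊗ pow A n)).hom)

theorem comulAt_zero_comp_counitAt_one (n : ℕ) :
    comulAt A (n + 1) 0 ≫ counitAt A (n + 1) 1 = 𝟙 (pow A (n + 1)) := by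
  have h : Δ[A] ▷ pow A n ≫ (A ◁ ε[A]) ▷ pow A n = (ρ_ A).inv ▷ pow A n := by
    rw [← comp_whiskerRight, ComonObj.comul_counit]
  rw [← Fin.succ_zero_eq_one, counitAt_succ]
  simpa [comulAt_zero, counitAt_zero] using
    h =≫ ((α_ A (𝟙_ C) (pow A n)).hom ≫ A ◁ (λ_ (pow A n)).hom)

theorem comulAt_comp_comulAt (n : ℕ) (i j : Fin n) (hij : i ≤ j) :
    comulAt A n i ≫ comulAt A (n + 1) j.succ = comulAt A n j ≫ comulAt A (n + 1) i.castSucc := by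
  induction n with
  | zero => exact i.elim0
  | succ n ih =>
    cases i using Fin.cases with
    | zero =>
      cases j using Fin.cases with
      | zero => exact comulAt_zero_comp_comulAt_one A n
      | succ j => exact (whiskerLeft_comp_comulAt_zero A (comulAt A n j)).symm
    | succ i =>
      cases j using Fin.cases with
      | zero => exact absurd hij (by simp)
      | succ j => exact ((CommSq.mk (ih i j (by simpa using hij))).map (tensorLeft A)).w

theorem counitAt_comp_counitAt (n : ℕ) (i j : Fin (n + 1)) (hij : i ≤ j) :
    counitAt A (n + 1) i.castSucc ≫ counitAt A n j =
      counitAt A (n + 1) j.succ ≫ counitAt A n i := by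
  induction n with
  | zero =>
    obtain rfl := Fin.fin_one_eq_zero i
    exact (whiskerLeft_comp_counitAt_zero A (counitAt A 0 j)).symm
  | succ n ih =>
    cases i using Fin.cases with
    | zero => exact (whiskerLeft_comp_counitAt_zero A (counitAt A (n + 1) j)).symm
    | succ i =>
      cases j using Fin.cases with
      | zero => exact absurd hij (by simp)
      | succ j => exact ((CommSq.mk (ih i j (by simpa using hij))).map (tensorLeft A)).w

theorem comulAt_comp_counitAt_of_le (n : ℕ) (i j : Fin (n + 1)) (hij : i ≤ j) :
    comulAt A (n + 2) i.castSucc ≫ counitAt A (n + 2) j.succ.succ =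
      counitAt A (n + 1) j.succ ≫ comulAt A (n + 1) i := by
  induction n with
  | zero =>
    obtain rfl := Fin.fin_one_eq_zero i
    exact (whiskerLeft_comp_comulAt_zero A (counitAt A 0 j)).symm
  | succ n ih =>
    cases i using Fin.cases with
    | zero => exact (whiskerLeft_comp_comulAt_zero A (counitAt A (n + 1) j)).symm
    | succ i =>
      cases j using Fin.cases with
      | zero => exact absurd hij (by simp)
      | succ j => exact ((CommSq.mk (ih i j (by simpa using hij))).map (tensorLeft A)).w

theorem comulAt_comp_counitAt_castSucc (n : ℕ) (i : Fin n) :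
    comulAt A n i ≫ counitAt A n i.castSucc = 𝟙 (pow A n) := by
  induction n with
  | zero => exact i.elim0
  | succ n ih =>
    cases i using Fin.cases with
    | zero => exact comulAt_zero_comp_counitAt_zero A n
    | succ i =>
      rw [comulAt_succ, Fin.castSucc_succ, counitAt_succ, ← whiskerLeft_comp, ih, whiskerLeft_id]

theorem comulAt_comp_counitAt_succ (n : ℕ) (i : Fin n) :
    comulAt A n i ≫ counitAt A n i.succ = 𝟙 (pow A n) := by
  induction n with
  | zero => exact i.elim0
  | succ n ih =>
    cases i using Fin.cases with
    | zero => exact comulAt_zero_comp_counitAt_one A n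
    | succ i => rw [comulAt_succ, counitAt_succ, ← whiskerLeft_comp, ih, whiskerLeft_id]

theorem comulAt_comp_counitAt_of_gt (n : ℕ) (i : Fin n) (j : Fin (n + 1)) (hij : j ≤ i.castSucc) :
    comulAt A (n + 1) i.succ ≫ counitAt A (n + 1) j.castSucc = counitAt A n j ≫ comulAt A n i := by
  induction n with
  | zero => exact i.elim0
  | succ n ih =>
    cases j using Fin.cases with
    | zero => exact whiskerLeft_comp_counitAt_zero A (comulAt A (n + 1) i)
    | succ j =>
      cases i using Fin.cases with
      | zero => exact absurd hij (by simp)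
      | succ i =>
        exact ((CommSq.mk (ih i j (by simpa [Fin.le_def] using hij))).map (tensorLeft A)).w

theorem comulAt_whiskerRight_comp_powSnoc (n : ℕ) (i : Fin n) :
    comulAt A n i ▷ A ≫ (powSnoc A (n + 1)).hom =
      (powSnoc A n).hom ≫ comulAt A (n + 1) i.castSucc := by
  induction n with
  | zero => exact i.elim0
  | succ n ih =>
    cases i using Fin.cases with
    | zero =>
      rw [Fin.castSucc_zero, comulAt_zero A (n + 1), powSnoc_succ_hom A n, Category.assoc,
        whisker_exchange_assoc, powSnoc_succ_hom A (n + 1), powSnoc_succ_hom A n, comulAt_zero]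
      simp
    | succ i =>
      rw [Fin.castSucc_succ, comulAt_succ, comulAt_succ, powSnoc_succ_hom A n, Category.assoc,
        ← whiskerLeft_comp, ← ih, powSnoc_succ_hom A (n + 1)]
      simp

theorem whiskerLeft_comul_comp_powSnoc (n : ℕ) :
    pow A n ◁ Δ[A] ≫ (α_ (pow A n) A A).inv ≫ (powSnoc A n).hom ▷ A ≫ (powSnoc A (n + 1)).hom =
      (powSnoc A n).hom ≫ comulAt A (n + 1) (Fin.last n) := by
  induction n with
  | zero => simp [powSnoc, comulAt]
  | succ n ih =>
    rw [← Fin.succ_last, comulAt_succ, powSnoc_succ_hom A n, Category.assoc, ← whiskerLeft_comp,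
      ← ih, powSnoc_succ_hom A (n + 1)]
    simp

theorem counitAt_whiskerRight_comp_powSnoc (n : ℕ) (i : Fin (n + 1)) :
    counitAt A n i ▷ A ≫ (powSnoc A n).hom =
      (powSnoc A (n + 1)).hom ≫ counitAt A (n + 1) i.castSucc := by
  induction n with
  | zero =>
    obtain rfl := Fin.fin_one_eq_zero i
    rw [Fin.castSucc_zero, counitAt_zero A 1, powSnoc_succ_hom A 0, Category.assoc,
      whisker_exchange_assoc, counitAt_zero]
    simp
  | succ n ih =>
    cases i using Fin.cases with
    | zero =>
      rw [Fin.castSucc_zero, counitAt_zero A (n + 2), powSnoc_succ_hom A (n + 1), Category.assoc,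
        whisker_exchange_assoc, counitAt_zero]
      simp
    | succ i =>
      rw [Fin.castSucc_succ, counitAt_succ, counitAt_succ, powSnoc_succ_hom A (n + 1),
        Category.assoc, ← whiskerLeft_comp, ← ih, powSnoc_succ_hom A n]
      simp

theorem powSnoc_comp_counitAt_last (n : ℕ) :
    (powSnoc A n).hom ≫ counitAt A n (Fin.last n) = pow A n ◁ ε[A] ≫ (ρ_ (pow A n)).hom := by
  induction n with
  | zero => simp [powSnoc, counitAt, unitors_equal, unitors_inv_equal]
  | succ n ih =>
    rw [← Fin.succ_last, counitAt_succ, powSnoc_succ_hom, Category.assoc, ← whiskerLeft_comp, ih]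
    simp

end Coalgebra

section Rotation

variable {C : Type u} [Category.{v} C] [MonoidalCategory C]

section Braided

variable [BraidedCategory C] {A : C}

/-- The rotation of `A^{⊗ (n+1)}` twisted by an endomorphism `L` of `A`:
`a₀ ⊗ ⋯ ⊗ aₙ ↦ a₁ ⊗ ⋯ ⊗ aₙ ⊗ L a₀`. -/
def rotation (L : A ⟶ A) (n : ℕ) : pow A (n + 1) ⟶ pow A (n + 1) :=
  L ▷ pow A n ≫ (β_ A (pow A n)).hom ≫ (powSnoc A n).hom

theorem whiskerLeft_comp_rotation (L : A ⟶ A) {m n : ℕ} {f : pow A m ⟶ pow A n}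
    {g : pow A (m + 1) ⟶ pow A (n + 1)}
    (h : f ▷ A ≫ (powSnoc A n).hom = (powSnoc A m).hom ≫ g) :
    A ◁ f ≫ rotation L n = rotation L m ≫ g := by
  simp only [rotation, Category.assoc]
  rw [← h, whisker_exchange_assoc, BraidedCategory.braiding_naturality_right_assoc]

variable [ComonObj A]

theorem comulAt_succ_comp_rotation (L : A ⟶ A) (n : ℕ) (i : Fin n) :
    comulAt A (n + 1) i.succ ≫ rotation L (n + 1) =
      rotation L n ≫ comulAt A (n + 1) i.castSucc :=
  whiskerLeft_comp_rotation L (comulAt_whiskerRight_comp_powSnoc A n i)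

theorem counitAt_succ_comp_rotation (L : A ⟶ A) (n : ℕ) (i : Fin (n + 1)) :
    counitAt A (n + 1) i.succ ≫ rotation L n =
      rotation L (n + 1) ≫ counitAt A (n + 1) i.castSucc :=
  whiskerLeft_comp_rotation L (counitAt_whiskerRight_comp_powSnoc A n i)

theorem rotation_comp_counitAt_last {L : A ⟶ A} (hL : L ≫ ε[A] = ε[A]) (n : ℕ) :
    rotation L n ≫ counitAt A n (Fin.last n) = counitAt A n 0 := by
  rw [rotation, counitAt_zero, Category.assoc, Category.assoc, powSnoc_comp_counitAt_last,
    ← BraidedCategory.braiding_naturality_left_assoc, ← comp_whiskerRight_assoc, hL]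
  simp

/-- The structure maps on the tensor powers `A^{⊗ (n+1)}` of a coalgebra, with cyclic operators the
rotations twisted by `L`. -/
abbrev rotationData (L : A ⟶ A) : CocyclicData C where
  X n := pow A (n + 1)
  δ n := Fin.lastCases (comulAt A (n + 1) 0 ≫ rotation L (n + 1))
    (fun i : Fin (n + 1) => comulAt A (n + 1) i)
  σ n i := counitAt A (n + 1) i.succ
  τ n := rotation L n

section rotationData

variable (L : A ⟶ A) (n : ℕ)

theorem rotationData_δ_castSucc (i : Fin (n + 1)) :
    (rotationData L).δ n i.castSucc = comulAt A (n + 1) i := by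
  simp only [rotationData, Fin.lastCases_castSucc]

theorem rotationData_δ_zero : (rotationData L).δ n 0 = comulAt A (n + 1) 0 :=
  rotationData_δ_castSucc L n 0

theorem rotationData_δ_last :
    (rotationData L).δ n (Fin.last (n + 1)) = comulAt A (n + 1) 0 ≫ rotation L (n + 1) := by
  simp only [rotationData, Fin.lastCases_last]

theorem rotationData_σ (i : Fin (n + 1)) :
    (rotationData L).σ n i = counitAt A (n + 1) i.succ := rfl

theorem rotationData_τ : (rotationData L).τ n = rotation L n := rfl

end rotationData

end Braided

section Symmetric

variable [SymmetricCategory C]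

theorem braiding_comp_braiding_cyclic (X Y Z : C) :
    (α_ X Y Z).hom ≫ (β_ X (Y ⊗ Z)).hom ≫ (α_ Y Z X).hom ≫ (β_ Y (Z ⊗ X)).hom =
      (β_ (X ⊗ Y) Z).hom ≫ (α_ Z X Y).inv := by
  rw [BraidedCategory.braiding_tensor_right_hom X Y Z]
  simp only [Category.assoc, Iso.inv_hom_id_assoc, Iso.hom_inv_id_assoc,
    BraidedCategory.braiding_naturality_right]
  rw [BraidedCategory.braiding_tensor_right_hom Y X Z]
  simp only [Category.assoc, Iso.hom_inv_id_assoc]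
  rw [← comp_whiskerRight_assoc, SymmetricCategory.symmetry,
    BraidedCategory.braiding_tensor_left_hom]
  simp

variable {A : C}

theorem comulAt_zero_comp_rotation_rotation [ComonObj A] {L : A ⟶ A}
    (hL : L ≫ Δ[A] = Δ[A] ≫ (L ⊗ₘ L)) (n : ℕ) :
    comulAt A (n + 1) 0 ≫ rotation L (n + 1) ≫ rotation L (n + 1) =
      rotation L n ≫ comulAt A (n + 1) (Fin.last n) := by
  have hΔ : Δ[A] ▷ pow A n ≫ (α_ A A (pow A n)).hom ≫ L ▷ (A ⊗ pow A n) ≫ A ◁ L ▷ pow A n =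
      L ▷ pow A n ≫ Δ[A] ▷ pow A n ≫ (α_ A A (pow A n)).hom := by
    rw [← comp_whiskerRight_assoc, hL, MonoidalCategory.tensorHom_def]
    simp
  rw [comulAt_zero, rotation, rotation, powSnoc_succ_hom A n]
  simp only [Category.assoc]
  rw [whisker_exchange_assoc, BraidedCategory.braiding_naturality_right_assoc,
    ← associator_naturality_left_assoc L (pow A n) A,
    ← BraidedCategory.braiding_naturality_right_assoc,
    reassoc_of% hΔ, reassoc_of% braiding_comp_braiding_cyclic A A (pow A n),
    BraidedCategory.braiding_naturality_left_assoc, ← whiskerLeft_comul_comp_powSnoc]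
  rfl

/-- The permutation inserting a factor at position `k`:
`a ⊗ x₀ ⊗ ⋯ ⊗ xₙ₋₁ ↦ x₀ ⊗ ⋯ ⊗ xₖ₋₁ ⊗ a ⊗ xₖ ⊗ ⋯ ⊗ xₙ₋₁`. -/
def insertAt (A : C) : (n : ℕ) → Fin (n + 1) → (A ⊗ pow A n ⟶ pow A (n + 1))
  | 0 => fun _ => 𝟙 (pow A 1)
  | n + 1 => Fin.cases (𝟙 (pow A (n + 2))) (fun k =>
      (α_ A A (pow A n)).inv ≫ (β_ A A).hom ▷ pow A n ≫ (α_ A A (pow A n)).hom ≫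
        A ◁ insertAt A n k)

theorem insertAt_zero (n : ℕ) : insertAt A n 0 = 𝟙 (pow A (n + 1)) := by cases n <;> rfl

theorem insertAt_succ (n : ℕ) (k : Fin (n + 1)) :
    insertAt A (n + 1) k.succ = (α_ A A (pow A n)).inv ≫ (β_ A A).hom ▷ pow A n ≫
      (α_ A A (pow A n)).hom ≫ A ◁ insertAt A n k := rfl

theorem insertAt_whiskerRight_comp_powSnoc (n : ℕ) (k : Fin (n + 1)) :
    insertAt A n k ▷ A ≫ (powSnoc A (n + 1)).hom =
      (α_ A (pow A n) A).hom ≫ A ◁ (powSnoc A n).hom ≫ insertAt A (n + 1) k.castSucc := by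
  induction n with
  | zero =>
    obtain rfl := Fin.fin_one_eq_zero k
    rw [Fin.castSucc_zero, insertAt_zero, insertAt_zero, id_whiskerRight, Category.id_comp,
      powSnoc_succ_hom, Category.comp_id]
  | succ n ih =>
    cases k using Fin.cases with
    | zero =>
      rw [Fin.castSucc_zero, insertAt_zero, insertAt_zero, id_whiskerRight, Category.id_comp,
        powSnoc_succ_hom, Category.comp_id]
    | succ k =>
      have ih' := congrArg (A ◁ ·) (ih k)
      simp only [whiskerLeft_comp] at ih'
      rw [insertAt_succ, Fin.castSucc_succ, insertAt_succ, powSnoc_succ_hom A (n + 1)]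
      simp only [comp_whiskerRight, Category.assoc, associator_naturality_middle_assoc, ih']
      have e : A ◁ A ◁ (powSnoc A n).hom ≫ (α_ A A _).inv ≫ (β_ A A).hom ▷ _ ≫ (α_ A A _).hom =
          (α_ A A (pow A n ⊗ A)).inv ≫ (β_ A A).hom ▷ (pow A n ⊗ A) ≫ (α_ A A (pow A n ⊗ A)).hom ≫
            A ◁ A ◁ (powSnoc A n).hom := by
        rw [associator_inv_naturality_right_assoc, whisker_exchange_assoc,
          associator_naturality_right]
      rw [powSnoc_succ_hom, whiskerLeft_comp, Category.assoc, reassoc_of% e]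
      simp

theorem insertAt_last (n : ℕ) :
    insertAt A n (Fin.last n) = (β_ A (pow A n)).hom ≫ (powSnoc A n).hom := by
  induction n with
  | zero => simp [insertAt, powSnoc]
  | succ n ih =>
    rw [← Fin.succ_last, insertAt_succ, ih, powSnoc_succ_hom]
    simp

theorem insertAt_succ_comp_rotation (L : A ⟶ A) (n : ℕ) (k : Fin (n + 1)) :
    insertAt A (n + 1) k.succ ≫ rotation L (n + 1) =
      A ◁ rotation L n ≫ insertAt A (n + 1) k.castSucc := by
  have e : (β_ A A).hom ▷ pow A n ≫ (L ▷ A) ▷ pow A n ≫ (β_ A A).hom ▷ pow A n =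
      (A ◁ L) ▷ pow A n := by
    simp only [← comp_whiskerRight, BraidedCategory.braiding_naturality_left,
      SymmetricCategory.symmetry_assoc]
  rw [insertAt_succ, rotation, rotation]
  simp only [Category.assoc]
  rw [whisker_exchange_assoc, BraidedCategory.braiding_naturality_right_assoc,
    insertAt_whiskerRight_comp_powSnoc, BraidedCategory.braiding_tensor_right_hom,
    ← associator_naturality_left_assoc]
  simp only [Category.assoc, Iso.hom_inv_id_assoc, reassoc_of% e,
    associator_naturality_middle_assoc, Iso.inv_hom_id_assoc, whiskerLeft_comp]

theorem insertAt_comp_endPow_rotation (L : A ⟶ A) (n : ℕ) (k : Fin (n + 2)) :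
    insertAt A (n + 1) k ≫ endPow (rotation L (n + 1)) k = A ◁ endPow (rotation L n) k := by
  induction k using Fin.induction with
  | zero =>
    rw [insertAt_zero, Category.id_comp, Fin.val_zero, endPow_zero, endPow_zero, whiskerLeft_id]
  | succ k ih =>
    rw [Fin.val_castSucc] at ih
    rw [Fin.val_succ, endPow_succ, endPow_succ, ← Category.assoc, insertAt_succ_comp_rotation,
      Category.assoc, ih, whiskerLeft_comp]

theorem endPow_rotation (L : A ⟶ A) (n : ℕ) : endPow (rotation L n) (n + 1) = powMap L (n + 1) := by
  induction n with
  | zero =>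
    simp [endPow_succ, endPow_zero, powMap, rotation, powSnoc, MonoidalCategory.tensorHom_def]
  | succ n ih =>
    have h := insertAt_comp_endPow_rotation L n (Fin.last (n + 1))
    rw [Fin.val_last, ih] at h
    calc endPow (rotation L (n + 1)) (n + 2)
      _ = L ▷ pow A (n + 1) ≫ insertAt A (n + 1) (Fin.last (n + 1)) ≫
          endPow (rotation L (n + 1)) (n + 1) := by
        rw [endPow_succ, insertAt_last, rotation, Category.assoc]
      _ = powMap L (n + 2) := by rw [h, ← MonoidalCategory.tensorHom_def]; rfl

section rotationData

variable [ComonObj A] {L : A ⟶ A} (n : ℕ)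

theorem rotationData_δ_comp_δ (hΔ : L ≫ Δ[A] = Δ[A] ≫ (L ⊗ₘ L)) (i j : Fin (n + 2))
    (hij : i ≤ j) :
    (rotationData L).δ n i ≫ (rotationData L).δ (n + 1) j.succ =
      (rotationData L).δ n j ≫ (rotationData L).δ (n + 1) i.castSucc := by
  cases j using Fin.lastCases with
  | cast j =>
    cases i using Fin.lastCases with
    | last => exact absurd hij (by simp)
    | cast i =>
      rw [Fin.succ_castSucc, rotationData_δ_castSucc, rotationData_δ_castSucc,
        rotationData_δ_castSucc, rotationData_δ_castSucc]
      exact comulAt_comp_comulAt A (n + 1) i j (by simpa using hij)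
  | last =>
    rw [Fin.succ_last, rotationData_δ_last, rotationData_δ_last, rotationData_δ_castSucc]
    cases i using Fin.lastCases with
    | cast i =>
      rw [rotationData_δ_castSucc, Category.assoc, ← comulAt_succ_comp_rotation]
      simp only [← Category.assoc]
      rw [comulAt_comp_comulAt A (n + 1) 0 i (Fin.zero_le _)]
      rfl
    | last =>
      have h := comulAt_succ_comp_rotation L (n + 1) 0
      rw [Fin.castSucc_zero] at h
      rw [rotationData_δ_last, Category.assoc, Category.assoc,
        ← comulAt_zero_comp_rotation_rotation hΔ, ← reassoc_of% h, ← Category.assoc,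
        comulAt_comp_comulAt A (n + 1) 0 0 le_rfl, Category.assoc]
      rfl

theorem rotationData_δ_succ_comp_σ (hε : L ≫ ε[A] = ε[A]) (i : Fin (n + 1)) :
    (rotationData L).δ n i.succ ≫ (rotationData L).σ n i = 𝟙 (pow A (n + 1)) := by
  cases i using Fin.lastCases with
  | last =>
    rw [Fin.succ_last, rotationData_δ_last, rotationData_σ, Fin.succ_last, Category.assoc,
      rotation_comp_counitAt_last hε (n + 1)]
    exact comulAt_comp_counitAt_castSucc A (n + 1) 0
  | cast i =>
    rw [Fin.succ_castSucc, rotationData_δ_castSucc]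
    exact comulAt_comp_counitAt_castSucc A (n + 1) i.succ

theorem rotationData_δ_comp_σ_of_gt (i : Fin (n + 2)) (j : Fin (n + 1)) (hij : j.castSucc < i) :
    (rotationData L).δ (n + 1) i.succ ≫ (rotationData L).σ (n + 1) j.castSucc =
      (rotationData L).σ n j ≫ (rotationData L).δ n i := by
  rw [rotationData_σ, rotationData_σ, Fin.succ_castSucc]
  cases i using Fin.lastCases with
  | last =>
    rw [Fin.succ_last, rotationData_δ_last, rotationData_δ_last, Category.assoc,
      ← counitAt_succ_comp_rotation, ← Category.assoc, ← Category.assoc,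
      ← comulAt_comp_counitAt_of_le A n 0 j (Fin.zero_le _)]
    rfl
  | cast i =>
    rw [Fin.succ_castSucc, rotationData_δ_castSucc, rotationData_δ_castSucc]
    exact comulAt_comp_counitAt_of_gt A (n + 1) i j.succ
      (Fin.succ_le_castSucc_iff.2 (Fin.castSucc_lt_castSucc_iff.1 hij))

theorem rotationData_δ_succ_comp_τ (hΔ : L ≫ Δ[A] = Δ[A] ≫ (L ⊗ₘ L)) (i : Fin (n + 1)) :
    (rotationData L).δ n i.succ ≫ (rotationData L).τ (n + 1) =
      (rotationData L).τ n ≫ (rotationData L).δ n i.castSucc := by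
  rw [rotationData_δ_castSucc, rotationData_τ, rotationData_τ]
  cases i using Fin.lastCases with
  | last =>
    rw [Fin.succ_last, rotationData_δ_last, Category.assoc]
    exact comulAt_zero_comp_rotation_rotation hΔ n
  | cast i =>
    rw [Fin.succ_castSucc, rotationData_δ_castSucc]
    exact comulAt_succ_comp_rotation L n i

theorem isParacocyclic_rotationData (hΔ : L ≫ Δ[A] = Δ[A] ≫ (L ⊗ₘ L)) (hε : L ≫ ε[A] = ε[A]) :
    (rotationData L).IsParacocyclic where
  δ_comp_δ n := rotationData_δ_comp_δ n hΔ
  σ_comp_σ n i j hij := counitAt_comp_counitAt A (n + 1) i.succ j.succ (by simpa using hij)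
  δ_comp_σ_of_le n i j hij := by
    cases i using Fin.lastCases with
    | last => exact absurd hij (by simp)
    | cast i =>
      rw [rotationData_δ_castSucc, rotationData_δ_castSucc]
      exact comulAt_comp_counitAt_of_le A n i j (by simpa using hij)
  δ_comp_σ_self n i := by
    rw [rotationData_δ_castSucc]
    exact comulAt_comp_counitAt_succ A (n + 1) i
  δ_comp_σ_succ n := rotationData_δ_succ_comp_σ n hε
  δ_comp_σ_of_gt n := rotationData_δ_comp_σ_of_gt n
  δ_succ_comp_τ n := rotationData_δ_succ_comp_τ n hΔ
  δ_zero_comp_τ n := by rw [rotationData_δ_zero, rotationData_δ_last, rotationData_τ]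
  σ_succ_comp_τ n i := counitAt_succ_comp_rotation L n i.succ
  σ_zero_comp_τ n := by
    have h := counitAt_succ_comp_rotation L n 0
    rw [Fin.castSucc_zero, ← rotation_comp_counitAt_last hε (n + 1)] at h
    exact h

end rotationData

end Symmetric

end Rotation

section Multiplication

variable {C : Type u} [Category.{v} C] [MonoidalCategory C]

/-- Left multiplication by an element `a : 𝟙_ C ⟶ Z` of a monoid object. -/
def mulLeft {Z : C} [MonObj Z] (a : 𝟙_ C ⟶ Z) : Z ⟶ Z := (λ_ Z).inv ≫ a ▷ Z ≫ μ[Z]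

/-- Right multiplication by an element `a : 𝟙_ C ⟶ Z` of a monoid object. -/
def mulRight {Z : C} [MonObj Z] (a : 𝟙_ C ⟶ Z) : Z ⟶ Z := (ρ_ Z).inv ≫ Z ◁ a ≫ μ[Z]

variable {Z W : C} [MonObj Z] [MonObj W]

theorem mul_comp_mulLeft (a : 𝟙_ C ⟶ Z) : μ[Z] ≫ mulLeft a = mulLeft a ▷ Z ≫ μ[Z] := by
  rw [mulLeft, leftUnitor_inv_naturality_assoc, whisker_exchange_assoc, MonObj.mul_assoc_flip]
  simp

theorem mul_comp_mulRight (a : 𝟙_ C ⟶ Z) : μ[Z] ≫ mulRight a = Z ◁ mulRight a ≫ μ[Z] := by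
  rw [mulRight, rightUnitor_inv_naturality_assoc, ← whisker_exchange_assoc, MonObj.mul_assoc]
  simp

theorem mulLeft_one : mulLeft η[Z] = 𝟙 Z := by simp [mulLeft]

theorem one_comp_mulLeft (a : 𝟙_ C ⟶ Z) : η[Z] ≫ mulLeft a = a := by
  rw [mulLeft, leftUnitor_inv_naturality_assoc, whisker_exchange_assoc, MonObj.mul_one,
    rightUnitor_naturality, unitors_inv_equal, Iso.inv_hom_id_assoc]

theorem one_comp_mulRight (a : 𝟙_ C ⟶ Z) : η[Z] ≫ mulRight a = a := by
  rw [mulRight, rightUnitor_inv_naturality_assoc, ← whisker_exchange_assoc, MonObj.one_mul,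
    leftUnitor_naturality, ← unitors_inv_equal, Iso.inv_hom_id_assoc]

theorem mulLeft_comp_mulLeft (a b : 𝟙_ C ⟶ Z) :
    mulLeft a ≫ mulLeft b = mulLeft ((λ_ (𝟙_ C)).inv ≫ (b ⊗ₘ a) ≫ μ[Z]) := by
  rw [mulLeft, Category.assoc, Category.assoc, mul_comp_mulLeft, ← comp_whiskerRight_assoc,
    mulLeft, leftUnitor_inv_naturality_assoc, whisker_exchange_assoc,
    ← MonoidalCategory.tensorHom_def_assoc, mulLeft]

theorem mulLeft_comp_mulRight (a b : 𝟙_ C ⟶ Z) :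
    mulLeft a ≫ mulRight b = mulRight b ≫ mulLeft a := by
  rw [mulLeft, Category.assoc, Category.assoc, mul_comp_mulRight, ← whisker_exchange_assoc,
    ← leftUnitor_inv_naturality_assoc]

theorem mulLeft_comp_hom (a : 𝟙_ C ⟶ Z) (f : Z ⟶ W) [IsMonHom f] :
    mulLeft a ≫ f = f ≫ mulLeft (a ≫ f) := by
  rw [mulLeft, mulLeft, leftUnitor_inv_naturality_assoc, whisker_exchange_assoc, Category.assoc,
    Category.assoc, IsMonHom.mul_hom, MonoidalCategory.tensorHom_def, Category.assoc,
    comp_whiskerRight_assoc]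

instance : IsMonHom η[Z] where
  mul_hom := by
    rw [MonoidalCategory.tensorHom_def', Category.assoc, MonObj.one_mul, leftUnitor_naturality]
    rfl

/-- `z ↦ z ⊗ 1`. -/
def includeLeft (Z W : C) [MonObj W] : Z ⟶ Z ⊗ W := (ρ_ Z).inv ≫ Z ◁ η[W]

/-- `w ↦ 1 ⊗ w`. -/
def includeRight (Z W : C) [MonObj Z] : W ⟶ Z ⊗ W := (λ_ W).inv ≫ η[Z] ▷ W

theorem includeRight_comp_whiskerLeft {V V' : C} (f : V ⟶ V') :
    includeRight Z V ≫ Z ◁ f = f ≫ includeRight Z V' := by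
  rw [includeRight, includeRight, Category.assoc, ← whisker_exchange,
    leftUnitor_inv_naturality_assoc]

variable [BraidedCategory C]

theorem mulLeft_tensor (a : 𝟙_ C ⟶ Z) (b : 𝟙_ C ⟶ W) :
    mulLeft ((λ_ (𝟙_ C)).inv ≫ (a ⊗ₘ b)) = mulLeft a ⊗ₘ mulLeft b := by
  have h : (λ_ (𝟙_ C)).inv ▷ (Z ⊗ W) ≫ tensorμ (𝟙_ C) (𝟙_ C) Z W =
      (λ_ (Z ⊗ W)).hom ≫ ((λ_ Z).inv ⊗ₘ (λ_ W).inv) := by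
    rw [tensor_left_unitality]
    simp
  simp only [mulLeft, MonObj.tensorObj.mul_def, comp_whiskerRight, Category.assoc]
  rw [tensorμ_natural_left_assoc, reassoc_of% h]
  simp

instance : IsMonHom (includeRight Z W) :=
  inferInstanceAs (IsMonHom ((λ_ W).inv ≫ η[Z] ▷ W))

theorem includeLeft_tensorHom_includeRight_comp_mul :
    (includeLeft Z W ⊗ₘ includeRight Z W) ≫ μ[Z ⊗ W] = 𝟙 (Z ⊗ W) := by
  have h := tensorμ_natural (𝟙 Z) η[W] η[Z] (𝟙 W)
  simp only [id_tensorHom, tensorHom_id] at h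
  rw [includeLeft, includeRight, MonObj.tensorObj.mul_def, ← tensorHom_comp_tensorHom,
    Category.assoc, reassoc_of% h, tensorHom_comp_tensorHom, MonObj.mul_one, MonObj.one_mul,
    tensorμ, braiding_tensorUnit_left]
  monoidal

theorem mulLeft_comp_includeRight (b : 𝟙_ C ⟶ W) :
    mulLeft (b ≫ includeRight Z W) = Z ◁ mulLeft b := by
  rw [← id_tensorHom, ← mulLeft_one, ← mulLeft_tensor, includeRight,
    leftUnitor_inv_naturality_assoc, whisker_exchange, ← MonoidalCategory.tensorHom_def]

end Multiplication

section CoequalizesMul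

variable {C : Type u} [Category.{v} C] [MonoidalCategory C] {X Y W Z Z' B : C} [MonObj Z]
  [MonObj Z']

/-- The morphism `q` on a monoid object identifies the products of `u` and `v` with anything:
`q (u(w) z) = q (v(w) z)`. -/
def CoequalizesMul (q : Z ⟶ B) (u v : W ⟶ Z) : Prop :=
  u ▷ Z ≫ μ[Z] ≫ q = v ▷ Z ≫ μ[Z] ≫ q

namespace CoequalizesMul

theorem precomp {q : Z ⟶ B} {u v : W ⟶ Z} (h : CoequalizesMul q u v) (w : X ⟶ W) :
    CoequalizesMul q (w ≫ u) (w ≫ v) := by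
  simp only [CoequalizesMul, comp_whiskerRight, Category.assoc] at h ⊢
  rw [h]

theorem mul_right {q : Z ⟶ B} {u v : X ⟶ Z} (h : CoequalizesMul q u v) (d : W ⟶ X ⊗ Y)
    (w : Y ⟶ Z) : CoequalizesMul q (d ≫ (u ⊗ₘ w) ≫ μ[Z]) (d ≫ (v ⊗ₘ w) ≫ μ[Z]) := by
  have assoc (u : X ⟶ Z) : (d ≫ (u ⊗ₘ w) ≫ μ[Z]) ▷ Z ≫ μ[Z] ≫ q =
      d ▷ Z ≫ (α_ X Y Z).hom ≫ X ◁ (w ▷ Z ≫ μ[Z]) ≫ u ▷ Z ≫ μ[Z] ≫ q := by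
    rw [whisker_exchange_assoc, MonoidalCategory.tensorHom_def]
    simp
  rw [CoequalizesMul, assoc, assoc, h]

theorem hom_comp {f : Z ⟶ Z'} [IsMonHom f] {q : Z' ⟶ B} {u v : W ⟶ Z}
    (h : CoequalizesMul q (u ≫ f) (v ≫ f)) : CoequalizesMul (f ≫ q) u v := by
  have map_mul (u : W ⟶ Z) : u ▷ Z ≫ μ[Z] ≫ f ≫ q = W ◁ f ≫ (u ≫ f) ▷ Z' ≫ μ[Z'] ≫ q := by
    rw [IsMonHom.mul_hom_assoc, MonoidalCategory.tensorHom_def, whisker_exchange_assoc]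
    simp
  rw [CoequalizesMul, map_mul, map_mul, h]

theorem mulLeft_comp {a : 𝟙_ C ⟶ Z} {q : Z ⟶ B} {u v : W ⟶ Z}
    (h : CoequalizesMul q (u ≫ mulLeft a) (v ≫ mulLeft a)) :
    CoequalizesMul (mulLeft a ≫ q) u v := by
  simpa only [CoequalizesMul, comp_whiskerRight, Category.assoc, reassoc_of% mul_comp_mulLeft a]
    using h

end CoequalizesMul

end CoequalizesMul

section Convolution

variable {C : Type u} [Category.{v} C] [MonoidalCategory C] {H Z W : C} [ComonObj H] [MonObj Z]
  [MonObj W]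

/-- The convolution product of `Conv H Z`, as an operation on morphisms `H ⟶ Z`. -/
def conv (f g : H ⟶ Z) : H ⟶ Z := (show Conv H Z from f) * (show Conv H Z from g)

theorem conv_eq (f g : H ⟶ Z) : conv f g = Δ[H] ≫ (f ⊗ₘ g) ≫ μ[Z] := by
  rw [MonoidalCategory.tensorHom_def, Category.assoc]
  exact Conv.mul_eq f g

theorem conv_assoc (f g k : H ⟶ Z) : conv (conv f g) k = conv f (conv g k) :=
  mul_assoc (G := Conv H Z) f g k

theorem conv_counit (f : H ⟶ Z) : conv f (ε[H] ≫ η[Z]) = f :=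
  mul_one (M := Conv H Z) f

theorem conv_comp (f g : H ⟶ Z) (φ : Z ⟶ W) [IsMonHom φ] :
    conv f g ≫ φ = conv (f ≫ φ) (g ≫ φ) := by
  simp [conv_eq]

theorem comp_one_conv (δ : H ⟶ 𝟙_ C) (f : H ⟶ Z) :
    conv (δ ≫ η[Z]) f = Δ[H] ≫ (δ ⊗ₘ f) ≫ (λ_ Z).hom := by
  rw [conv_eq, ← MonObj.one_mul]
  simp [MonoidalCategory.tensorHom_def']

theorem CoequalizesMul.conv_right {B : C} {q : Z ⟶ B} {u v : H ⟶ Z} (h : CoequalizesMul q u v)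
    (w : H ⟶ Z) : CoequalizesMul q (conv u w) (conv v w) := by
  rw [conv_eq, conv_eq]
  exact h.mul_right Δ[H] w

end Convolution

section Hopf

variable {C : Type u} [Category.{v} C] [MonoidalCategory C] [BraidedCategory C]

instance (H : C) [BimonObj H] : IsMonHom Δ[H] where
  one_hom := BimonObj.one_comul H
  mul_hom := BimonObj.mul_comul H

instance (H : C) [BimonObj H] : IsMonHom ε[H] where
  one_hom := BimonObj.one_counit H
  mul_hom := Bimon.mul_counit H

variable {H : C} [HopfObj H]

theorem twistedAntipode_eq_conv (δ : H ⟶ 𝟙_ C) : twistedAntipode δ = conv (δ ≫ η[H]) 𝒮[H] :=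
  (comp_one_conv δ 𝒮[H]).symm

theorem antipode_conv_id : conv 𝒮[H] (𝟙 H) = ε[H] ≫ η[H] := by
  rw [conv_eq, tensorHom_id, HopfObj.antipode_left]

theorem id_conv_antipode : conv (𝟙 H) 𝒮[H] = ε[H] ≫ η[H] := by
  rw [conv_eq, id_tensorHom, HopfObj.antipode_right]

theorem twistedAntipode_conv_id (δ : H ⟶ 𝟙_ C) : conv (twistedAntipode δ) (𝟙 H) = δ ≫ η[H] := by
  rw [twistedAntipode_eq_conv, conv_assoc, antipode_conv_id, conv_counit]

theorem twistedAntipode_comp_counit (δ : H ⟶ 𝟙_ C) : twistedAntipode δ ≫ ε[H] = δ := by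
  rw [twistedAntipode, Category.assoc, Category.assoc, ← leftUnitor_naturality, ← id_tensorHom,
    tensorHom_comp_tensorHom_assoc, HopfObj.antipode_counit, ComonObj.comul_counit_hom_assoc,
    unitors_equal, Iso.inv_hom_id, Category.comp_id, Category.comp_id]

variable {δ : H ⟶ 𝟙_ C}

theorem one_comp_twistedAntipode (hδ : IsCharacter δ) : η[H] ≫ twistedAntipode δ = η[H] := by
  rw [twistedAntipode, Bimon.one_comul_assoc, tensorHom_comp_tensorHom_assoc, hδ.one,
    HopfObj.one_antipode, id_tensorHom, leftUnitor_naturality, Iso.inv_hom_id_assoc]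

theorem mul_comp_twistedAntipode (hδ : IsCharacter δ) :
    μ[H] ≫ twistedAntipode δ =
      (twistedAntipode δ ⊗ₘ twistedAntipode δ) ≫ (β_ H H).hom ≫ μ[H] := by
  rw [twistedAntipode, BimonObj.mul_comul_assoc, tensorHom_comp_tensorHom_assoc, hδ.mul,
    HopfObj.mul_antipode, ← tensorHom_comp_tensorHom_assoc, ← tensorμ_natural_assoc,
    tensorHom_comp_tensorHom_assoc]
  simp only [← tensorHom_comp_tensorHom, Category.assoc]
  rw [leftUnitor_monoidal H H]
  simp [MonoidalCategory.tensorHom_def]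

variable {σ : 𝟙_ C ⟶ H}

theorem mulLeft_comp_comul (hσ : IsCocharacter σ) :
    mulLeft σ ≫ Δ[H] = Δ[H] ≫ (mulLeft σ ⊗ₘ mulLeft σ) := by
  rw [mulLeft_comp_hom, hσ.comul, mulLeft_tensor]

theorem mulLeft_comp_counit (hσ : IsCocharacter σ) : mulLeft σ ≫ ε[H] = ε[H] := by
  rw [mulLeft_comp_hom, hσ.counit]
  exact (congrArg (ε[H] ≫ ·) (mulLeft_one (Z := 𝟙_ C))).trans (Category.comp_id _)

theorem mulLeft_antipode_comp_mulLeft (hσ : IsCocharacter σ) :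
    mulLeft (σ ≫ 𝒮[H]) ≫ mulLeft σ = 𝟙 H := by
  have h : (λ_ (𝟙_ C)).inv ≫ (σ ⊗ₘ σ ≫ 𝒮[H]) ≫ μ[H] = η[H] := by
    have split : (σ ⊗ₘ σ ≫ 𝒮[H]) = (σ ⊗ₘ σ) ≫ H ◁ 𝒮[H] := by
      simp [MonoidalCategory.tensorHom_def]
    rw [split, Category.assoc, ← reassoc_of% hσ.comul, HopfObj.antipode_right,
      ← Category.assoc, hσ.counit, Category.id_comp]
  rw [mulLeft_comp_mulLeft, h, mulLeft_one]

namespace IsBraidedMPI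

theorem mulLeft_eq (h : IsBraidedMPI δ σ) :
    mulLeft σ = (twistedAntipode δ ≫ twistedAntipode δ) ≫ mulRight σ := by
  have two_sided_mul (s : H ⟶ H) (a : 𝟙_ C ⟶ H) : s ≫ mulLeft a ≫ mulRight σ =
      (λ_ H).inv ≫ (ρ_ (𝟙_ C ⊗ H)).inv ≫ ((a ⊗ₘ s) ⊗ₘ σ) ≫ μ[H] ▷ H ≫ μ[H] := by
    rw [mulLeft, mulRight, Category.assoc, Category.assoc, leftUnitor_inv_naturality_assoc,
      ← MonoidalCategory.tensorHom_def'_assoc, rightUnitor_inv_naturality_assoc,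
      rightUnitor_inv_naturality_assoc, MonoidalCategory.tensorHom_def (a ⊗ₘ s), Category.assoc,
      whisker_exchange_assoc]
  have hi := h.involution
  rw [← two_sided_mul, mulLeft_comp_mulRight] at hi
  calc mulLeft σ
    _ = ((twistedAntipode δ ≫ twistedAntipode δ) ≫ mulRight σ ≫ mulLeft (σ ≫ 𝒮[H])) ≫
        mulLeft σ := by rw [hi, Category.id_comp]
    _ = (twistedAntipode δ ≫ twistedAntipode δ) ≫ mulRight σ := by
      rw [Category.assoc, Category.assoc, Category.assoc,
        mulLeft_antipode_comp_mulLeft h.cocharacter, Category.comp_id, Category.assoc]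

/-- `S̃(h₂) σ h₁ = δ(h) σ`. -/
theorem comul_braiding_twistedAntipode_mulLeft (h : IsBraidedMPI δ σ) :
    Δ[H] ≫ (β_ H H).hom ≫ (twistedAntipode δ ⊗ₘ mulLeft σ) ≫ μ[H] = δ ≫ σ := by
  have mul_σ : (twistedAntipode δ ⊗ₘ mulLeft σ) ≫ μ[H] =
      (twistedAntipode δ ⊗ₘ (twistedAntipode δ ≫ twistedAntipode δ)) ≫ μ[H] ≫ mulRight σ := by
    rw [h.mulLeft_eq, mul_comp_mulRight]
    simp [MonoidalCategory.tensorHom_def]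
  have swap : (β_ H H).hom ≫ (twistedAntipode δ ⊗ₘ (twistedAntipode δ ≫ twistedAntipode δ)) =
      twistedAntipode δ ▷ H ≫ (twistedAntipode δ ⊗ₘ twistedAntipode δ) ≫ (β_ H H).hom := by
    rw [← BraidedCategory.braiding_naturality]
    simp [MonoidalCategory.tensorHom_def]
  have cancel := twistedAntipode_conv_id δ
  rw [conv_eq, tensorHom_id] at cancel
  rw [mul_σ, reassoc_of% swap, ← reassoc_of% mul_comp_twistedAntipode h.character,
    reassoc_of% cancel, reassoc_of% one_comp_twistedAntipode h.character, one_comp_mulRight]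

end IsBraidedMPI

end Hopf

section Retraction

variable {C : Type u} [Category.{v} C] [MonoidalCategory C]

section Braided

variable [BraidedCategory C]

/-- `(b a) (x y) = (b (a x)) y`. -/
theorem tensorμ_braiding_mul (P : C) [MonObj P] :
    tensorμ P P P P ≫ (((β_ P P).hom ≫ μ[P]) ⊗ₘ μ[P]) ≫ μ[P] =
      (α_ (P ⊗ P) P P).inv ≫ (μ[P] ▷ P ≫ (β_ P P).hom ≫ μ[P]) ▷ P ≫ μ[P] := by
  have assoc : μ[P] ▷ P ▷ P ≫ (α_ P P P).hom ≫ P ◁ μ[P] ≫ μ[P] =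
      (α_ P P P).hom ▷ P ≫ (α_ P (P ⊗ P) P).hom ≫ P ◁ μ[P] ▷ P ≫ P ◁ μ[P] ≫ μ[P] := by
    rw [associator_naturality_left_assoc, ← whisker_exchange_assoc, MonObj.mul_assoc,
      ← whiskerLeft_comp_assoc P (μ[P] ▷ P), MonObj.mul_assoc]
    simp
  rw [BraidedCategory.braiding_naturality_left_assoc, BraidedCategory.braiding_tensor_left_hom]
  simp [tensorμ, MonoidalCategory.tensorHom_def, assoc]

theorem one_whiskerRight_braiding_mul (P : C) [MonObj P] :
    η[P] ▷ P ≫ (β_ P P).hom ≫ μ[P] = (λ_ P).hom := by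
  rw [BraidedCategory.braiding_naturality_left_assoc, MonObj.mul_one]
  simp

/-- `φ (h₁ a) (d (h₂) x) = φ a (φ (h₁) (d (h₂) x)) = δ (h) (φ (a) x)` for an antimultiplicative
`φ` that is convolved with `d` to `δ`. -/
theorem coequalizesMul_of_mul_comp {H P : C} [MonObj H] [ComonObj H] [MonObj P] {δ : H ⟶ 𝟙_ C}
    {φ d : H ⟶ P}
    (hφ : μ[H] ≫ φ = (φ ⊗ₘ φ) ≫ (β_ P P).hom ≫ μ[P]) (hd : conv φ d = δ ≫ η[P]) :
    CoequalizesMul (φ ▷ P ≫ μ[P]) (Δ[H] ≫ H ◁ d) (δ ≫ η[H ⊗ P]) := by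
  rw [conv_eq] at hd
  have expand : (μ[H] ⊗ₘ μ[P]) ≫ φ ▷ P ≫ μ[P] =
      ((φ ⊗ₘ φ) ⊗ₘ 𝟙 (P ⊗ P)) ≫ (((β_ P P).hom ≫ μ[P]) ⊗ₘ μ[P]) ≫ μ[P] := by
    rw [tensorHom_comp_tensorHom_assoc, ← hφ, Category.id_comp, ← tensorHom_id,
      tensorHom_comp_tensorHom_assoc, Category.comp_id]
  have shuffle : tensorμ H P H P ≫ ((φ ⊗ₘ φ) ⊗ₘ 𝟙 (P ⊗ P)) =
      ((φ ⊗ₘ 𝟙 P) ⊗ₘ (φ ⊗ₘ 𝟙 P)) ≫ tensorμ P P P P := by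
    rw [tensorμ_natural, id_tensorHom_id]
  have slide : (Δ[H] ≫ H ◁ d) ▷ (H ⊗ P) ≫ ((φ ⊗ₘ 𝟙 P) ⊗ₘ (φ ⊗ₘ 𝟙 P)) =
      (H ◁ φ ▷ P) ≫ (Δ[H] ≫ (φ ⊗ₘ d)) ▷ (P ⊗ P) := by
    rw [whisker_exchange, MonoidalCategory.tensorHom_def (φ ⊗ₘ 𝟙 P), ← comp_whiskerRight_assoc]
    simp [MonoidalCategory.tensorHom_def']
  have cancel : (Δ[H] ≫ (φ ⊗ₘ d)) ▷ (P ⊗ P) ≫ (α_ (P ⊗ P) P P).inv ≫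
      (μ[P] ▷ P ≫ (β_ P P).hom ≫ μ[P]) ▷ P = δ ▷ (P ⊗ P) ≫ (λ_ (P ⊗ P)).hom := by
    rw [associator_inv_naturality_left_assoc, ← comp_whiskerRight, ← comp_whiskerRight_assoc,
      Category.assoc, hd, comp_whiskerRight δ, Category.assoc, one_whiskerRight_braiding_mul]
    simp
  rw [CoequalizesMul, comp_whiskerRight δ, Category.assoc, MonObj.one_mul_assoc,
    MonObj.tensorObj.mul_def, Category.assoc, expand, reassoc_of% shuffle, tensorμ_braiding_mul,
    reassoc_of% slide, reassoc_of% cancel, whisker_exchange_assoc, leftUnitor_naturality_assoc]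

variable {H P : C} [HopfObj H] [MonObj P] {δ : H ⟶ 𝟙_ C}

/-- `h x ⊗ y = h₁ x ⊗ h₂ S(h₃) y = x ⊗ S̃(h) y` in any quotient on which `H` acts through `δ`. -/
theorem CoequalizesMul.swap {X Y B : C} [MonObj X] [MonObj Y] {f : H ⟶ X} {g : H ⟶ Y} [IsMonHom g]
    {q : X ⊗ Y ⟶ B} (h : CoequalizesMul q (Δ[H] ≫ (f ⊗ₘ g)) (δ ≫ η[X ⊗ Y])) :
    CoequalizesMul q (f ≫ includeLeft X Y) (twistedAntipode δ ≫ g ≫ includeRight X Y) := by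
  have diag : Δ[H] ≫ (f ⊗ₘ g) = conv (f ≫ includeLeft X Y) (g ≫ includeRight X Y) := by
    rw [conv_eq, ← tensorHom_comp_tensorHom_assoc, includeLeft_tensorHom_includeRight_comp_mul,
      Category.comp_id]
  have cancel : conv (g ≫ includeRight X Y) (𝒮[H] ≫ g ≫ includeRight X Y) = ε[H] ≫ η[X ⊗ Y] := by
    have := conv_comp (𝟙 H) 𝒮[H] (g ≫ includeRight X Y)
    rw [id_conv_antipode, Category.id_comp, Category.assoc, IsMonHom.one_hom] at this
    exact this.symm
  have multiplied := h.conv_right (𝒮[H] ≫ g ≫ includeRight X Y)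
  rw [diag, conv_assoc, cancel, conv_counit] at multiplied
  rwa [twistedAntipode_eq_conv, conv_comp, Category.assoc, IsMonHom.one_hom]

/-- `h ⊗ x ↦ S̃(h) x`, where `H` acts on `P` by left multiplication through `d`. -/
def retraction (δ : H ⟶ 𝟙_ C) (d : H ⟶ P) : H ⊗ P ⟶ P := (twistedAntipode δ ≫ d) ▷ P ≫ μ[P]

variable (d : H ⟶ P) [IsMonHom d]

theorem coequalizesMul_retraction (hδ : IsCharacter δ) :
    CoequalizesMul (retraction δ d) (Δ[H] ≫ H ◁ d) (δ ≫ η[H ⊗ P]) := by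
  refine coequalizesMul_of_mul_comp ?_ ?_
  · rw [reassoc_of% mul_comp_twistedAntipode hδ, IsMonHom.mul_hom,
      ← BraidedCategory.braiding_naturality_assoc, tensorHom_comp_tensorHom_assoc]
  · have := conv_comp (twistedAntipode δ) (𝟙 H) d
    rw [twistedAntipode_conv_id, Category.id_comp, Category.assoc, IsMonHom.one_hom] at this
    exact this.symm

theorem includeRight_comp_retraction (hδ : IsCharacter δ) :
    includeRight H P ≫ retraction δ d = 𝟙 P := by
  rw [includeRight, retraction, Category.assoc, ← comp_whiskerRight_assoc,
    reassoc_of% one_comp_twistedAntipode hδ, IsMonHom.one_hom, MonObj.one_mul, Iso.inv_hom_id]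

theorem CoequalizesMul.retraction_includeRight_comp {B : C} {q : H ⊗ P ⟶ B}
    (h : CoequalizesMul q (Δ[H] ≫ H ◁ d) (δ ≫ η[H ⊗ P])) :
    retraction δ d ≫ includeRight H P ≫ q = q := by
  rw [← id_tensorHom] at h
  have swap : H ◁ includeRight H P ≫ _ = H ◁ includeRight H P ≫ _ :=
    congrArg (H ◁ includeRight H P ≫ ·) h.swap
  rw [whisker_exchange_assoc, whisker_exchange_assoc, ← MonoidalCategory.tensorHom_def_assoc,
    ← MonoidalCategory.tensorHom_def_assoc, Category.id_comp,
    reassoc_of% includeLeft_tensorHom_includeRight_comp_mul] at swap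
  conv_rhs => rw [swap]
  rw [retraction, ← Category.assoc (twistedAntipode δ), Category.assoc, IsMonHom.mul_hom_assoc,
    ← tensorHom_id, tensorHom_comp_tensorHom_assoc, Category.id_comp]

end Braided

theorem CoequalizesMul.mulLeft_braiding_comp [SymmetricCategory C] {H P B : C} [HopfObj H]
    [MonObj P] {δ : H ⟶ 𝟙_ C} {σ : 𝟙_ C ⟶ H} (h : IsBraidedMPI δ σ) {d : H ⟶ P} {q : P ⊗ H ⟶ B}
    (hq : CoequalizesMul q (Δ[H] ≫ d ▷ H) (δ ≫ η[P ⊗ H])) :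
    CoequalizesMul (mulLeft σ ▷ P ≫ (β_ H P).hom ≫ q) (Δ[H] ≫ H ◁ d) (δ ≫ η[H ⊗ P]) := by
  rw [← tensorHom_id] at hq
  have swapped := hq.swap.mul_right (Δ[H] ≫ (β_ H H).hom) (mulLeft σ ≫ includeRight P H)
  have diag : (Δ[H] ≫ H ◁ d) ≫ (β_ H P).hom ≫ P ◁ mulLeft σ =
      (Δ[H] ≫ (β_ H H).hom) ≫
        (d ≫ includeLeft P H ⊗ₘ mulLeft σ ≫ includeRight P H) ≫ μ[P ⊗ H] := by
    rw [← tensorHom_comp_tensorHom_assoc, includeLeft_tensorHom_includeRight_comp_mul]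
    simp [MonoidalCategory.tensorHom_def]
  have scalar : (Δ[H] ≫ (β_ H H).hom) ≫
      (twistedAntipode δ ≫ 𝟙 H ≫ includeRight P H ⊗ₘ mulLeft σ ≫ includeRight P H) ≫ μ[P ⊗ H] =
        (δ ≫ η[H ⊗ P]) ≫ (β_ H P).hom ≫ P ◁ mulLeft σ := by
    rw [Category.id_comp, ← tensorHom_comp_tensorHom_assoc, ← IsMonHom.mul_hom, Category.assoc,
      Category.assoc, IsMonHom.one_hom_assoc,
      reassoc_of% h.comul_braiding_twistedAntipode_mulLeft, ← IsMonHom.one_hom (includeRight P H),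
      Category.assoc, includeRight_comp_whiskerLeft, reassoc_of% one_comp_mulLeft σ]
  rw [← diag, scalar] at swapped
  rw [BraidedCategory.braiding_naturality_left_assoc]
  refine hom_comp ?_
  rw [← mulLeft_comp_includeRight]
  refine mulLeft_comp ?_
  rw [mulLeft_comp_includeRight]
  simpa only [Category.assoc] using swapped

end Retraction

section Powers

variable {C : Type u} [Category.{v} C] [MonoidalCategory C]

theorem snocMap_succ {H : C} (σ : 𝟙_ C ⟶ H) (n : ℕ) : snocMap σ (n + 1) = H ◁ snocMap σ n := by
  rw [snocMap, snocMap, powSnoc_succ_hom]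
  simp

section Comultiplication

variable (H : C) [ComonObj H]

/-- The iterated comultiplication `H ⟶ H^{⊗ n}`, which for `n = 0` is the counit. -/
def diagPow : (n : ℕ) → (H ⟶ pow H n)
  | 0 => ε[H]
  | n + 1 => Δ[H] ≫ H ◁ diagPow n

theorem diagPow_succ (n : ℕ) : diagPow H (n + 1) = Δ[H] ≫ H ◁ diagPow H n := rfl

theorem comulPow_eq_diagPow (n : ℕ) : comulPow H n = diagPow H (n + 1) := by
  induction n with
  | zero => exact (ComonObj.comul_counit H).symm
  | succ n ih => rw [diagPow_succ, comulPow, ih]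

theorem diagPow_comp_comulAt (n : ℕ) (i : Fin n) :
    diagPow H n ≫ comulAt H n i = diagPow H (n + 1) := by
  induction n with
  | zero => exact i.elim0
  | succ n ih =>
    cases i using Fin.cases with
    | zero => simp [diagPow_succ, comulAt_zero, whisker_exchange_assoc]
    | succ i =>
      rw [diagPow_succ, comulAt_succ, Category.assoc, ← whiskerLeft_comp, ih, ← diagPow_succ]

theorem diagPow_comp_counitAt (n : ℕ) (i : Fin (n + 1)) :
    diagPow H (n + 1) ≫ counitAt H n i = diagPow H n := by
  have counitAt_zero_case (n : ℕ) : diagPow H (n + 1) ≫ counitAt H n 0 = diagPow H n := by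
    simp [diagPow_succ, counitAt_zero, whisker_exchange_assoc]
  induction n with
  | zero =>
    obtain rfl := Fin.fin_one_eq_zero i
    exact counitAt_zero_case 0
  | succ n ih =>
    cases i using Fin.cases with
    | zero => exact counitAt_zero_case (n + 1)
    | succ i =>
      rw [diagPow_succ, counitAt_succ, Category.assoc, ← whiskerLeft_comp, ih, ← diagPow_succ]

theorem comul_diagPow_comp_powSnoc (n : ℕ) :
    (Δ[H] ≫ diagPow H n ▷ H) ≫ (powSnoc H n).hom = diagPow H (n + 1) := by
  induction n with
  | zero => simp [diagPow, powSnoc]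
  | succ n ih =>
    rw [diagPow_succ H n, diagPow_succ H (n + 1), ← ih, powSnoc_succ_hom]
    simp

end Comultiplication

section Braided

variable [BraidedCategory C]

instance powMonObj (H : C) [MonObj H] : (n : ℕ) → MonObj (pow H n)
  | 0 => inferInstanceAs (MonObj (𝟙_ C))
  | n + 1 =>
    letI := powMonObj H n
    inferInstanceAs (MonObj (H ⊗ pow H n))

theorem mulPow_eq_mul (H : C) [MonObj H] (n : ℕ) : mulPow H n = μ[pow H n] := by
  induction n with
  | zero => exact Category.comp_id _
  | succ n ih =>
    change (tensorμ H (pow H n) H (pow H n) ≫ (H ⊗ H) ◁ interleave H H n) ≫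
      (μ[H] ⊗ₘ powMap μ[H] n) = tensorμ H (pow H n) H (pow H n) ≫ (μ[H] ⊗ₘ μ[pow H n])
    rw [← ih, mulPow, Category.assoc, ← id_tensorHom, tensorHom_comp_tensorHom, Category.id_comp]

section Bimonoid

variable (H : C) [BimonObj H]

instance isMonHom_diagPow (n : ℕ) : IsMonHom (diagPow H n) := by
  induction n with
  | zero => exact inferInstanceAs (IsMonHom ε[H])
  | succ n ih => exact inferInstanceAs (IsMonHom (Δ[H] ≫ H ◁ diagPow H n))

instance isMonHom_comulAt (n : ℕ) (i : Fin n) : IsMonHom (comulAt H n i) := by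
  induction n with
  | zero => exact i.elim0
  | succ n ih =>
    cases i using Fin.cases with
    | zero => exact inferInstanceAs (IsMonHom (Δ[H] ▷ pow H n ≫ (α_ H H (pow H n)).hom))
    | succ i =>
      have := ih i
      exact inferInstanceAs (IsMonHom (H ◁ comulAt H n i))

instance isMonHom_counitAt (n : ℕ) (i : Fin (n + 1)) : IsMonHom (counitAt H n i) := by
  induction n with
  | zero =>
    obtain rfl := Fin.fin_one_eq_zero i
    exact inferInstanceAs (IsMonHom (ε[H] ▷ 𝟙_ C ≫ (λ_ (𝟙_ C)).hom))
  | succ n ih =>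
    cases i using Fin.cases with
    | zero => exact inferInstanceAs (IsMonHom (ε[H] ▷ pow H (n + 1) ≫ (λ_ (pow H (n + 1))).hom))
    | succ i =>
      have := ih i
      exact inferInstanceAs (IsMonHom (H ◁ counitAt H n i))

instance isMonHom_powSnoc_hom (n : ℕ) : IsMonHom (powSnoc H n).hom := by
  induction n with
  | zero => exact inferInstanceAs (IsMonHom ((λ_ H).hom ≫ (ρ_ H).inv))
  | succ n ih =>
    exact inferInstanceAs (IsMonHom ((α_ H (pow H n) H).hom ≫ H ◁ (powSnoc H n).hom))

end Bimonoid

variable {H B : C} [HopfObj H] {δ : H ⟶ 𝟙_ C} {σ : 𝟙_ C ⟶ H}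

/-- The diagonal action of `H` on `H^{⊗ (n+1)}` becomes multiplication by `δ` after composing
with `q`, i.e. `q` factors through `^σI_δ ⊗_H H^{⊗ (n+1)}`. -/
def IsBalanced (δ : H ⟶ 𝟙_ C) {n : ℕ} (q : pow H (n + 1) ⟶ B) : Prop :=
  CoequalizesMul q (diagPow H (n + 1)) (δ ≫ η[pow H (n + 1)])

/-- The retraction `h ⊗ x ↦ S̃(h) x` of `H^{⊗ (n+1)}` onto `H^{⊗ n}`. -/
def powRetraction (δ : H ⟶ 𝟙_ C) (n : ℕ) : pow H (n + 1) ⟶ pow H n := retraction δ (diagPow H n)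

theorem consUnit_comp_powRetraction (hδ : IsCharacter δ) (n : ℕ) :
    consUnit H n ≫ powRetraction δ n = 𝟙 (pow H n) :=
  includeRight_comp_retraction (diagPow H n) hδ

theorem isBalanced_powRetraction (hδ : IsCharacter δ) (n : ℕ) :
    IsBalanced δ (powRetraction δ n) :=
  coequalizesMul_retraction (diagPow H n) hδ

theorem powMap_mulLeft (hσ : IsCocharacter σ) (n : ℕ) :
    powMap (mulLeft σ) n = mulLeft (σ ≫ diagPow H n) := by
  induction n with
  | zero =>
    rw [diagPow, hσ.counit]
    exact (mulLeft_one (Z := 𝟙_ C)).symm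
  | succ n ih =>
    rw [powMap, ih, ← mulLeft_tensor, diagPow_succ, reassoc_of% hσ.comul, ← id_tensorHom,
      tensorHom_comp_tensorHom, Category.comp_id]

namespace IsBalanced

theorem powRetraction_comp {n : ℕ} {q : pow H (n + 1) ⟶ B} (hq : IsBalanced δ q) :
    powRetraction δ n ≫ consUnit H n ≫ q = q :=
  CoequalizesMul.retraction_includeRight_comp (diagPow H n) hq

theorem comp {m n : ℕ} (f : pow H (m + 1) ⟶ pow H (n + 1)) [IsMonHom f]
    (hf : diagPow H (m + 1) ≫ f = diagPow H (n + 1)) {q : pow H (n + 1) ⟶ B}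
    (hq : IsBalanced δ q) : IsBalanced δ (f ≫ q) := by
  refine CoequalizesMul.hom_comp ?_
  rwa [hf, Category.assoc, IsMonHom.one_hom]

theorem rotationData_σ_comp {n : ℕ} (i : Fin (n + 1)) {q : pow H (n + 1) ⟶ B}
    (hq : IsBalanced δ q) : IsBalanced (n := n + 1) δ ((rotationData (mulLeft σ)).σ n i ≫ q) :=
  hq.comp (counitAt H (n + 1) i.succ) (diagPow_comp_counitAt H (n + 1) i.succ)

theorem powMap_mulLeft_comp (hσ : IsCocharacter σ) (hσδ : σ ≫ δ = 𝟙 (𝟙_ C)) {n : ℕ}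
    {q : pow H (n + 1) ⟶ B} (hq : IsBalanced δ q) : powMap (mulLeft σ) (n + 1) ≫ q = q := by
  have act_σ : (σ ≫ diagPow H (n + 1)) ▷ _ ≫ _ = _ ▷ _ ≫ _ := hq.precomp σ
  rw [reassoc_of% hσδ, MonObj.one_mul_assoc] at act_σ
  rw [powMap_mulLeft hσ, mulLeft, Category.assoc, Category.assoc, act_σ, Iso.inv_hom_id_assoc]

end IsBalanced

end Braided

section Symmetric

variable [SymmetricCategory C] {H B : C} [HopfObj H] {δ : H ⟶ 𝟙_ C} {σ : 𝟙_ C ⟶ H}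

namespace IsBalanced

theorem rotation_comp (h : IsBraidedMPI δ σ) {n : ℕ} {q : pow H (n + 1) ⟶ B}
    (hq : IsBalanced δ q) : IsBalanced δ (rotation (mulLeft σ) n ≫ q) := by
  have balanced_snoc : CoequalizesMul ((powSnoc H n).hom ≫ q) (Δ[H] ≫ diagPow H n ▷ H)
      (δ ≫ η[pow H n ⊗ H]) := by
    refine CoequalizesMul.hom_comp ?_
    rwa [comul_diagPow_comp_powSnoc, Category.assoc, IsMonHom.one_hom]
  rw [rotation, Category.assoc, Category.assoc]
  exact balanced_snoc.mulLeft_braiding_comp h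

theorem rotationData_δ_comp (h : IsBraidedMPI δ σ) {n : ℕ} (i : Fin (n + 2))
    {q : pow H (n + 2) ⟶ B} (hq : IsBalanced δ q) :
    IsBalanced (n := n) δ ((rotationData (mulLeft σ)).δ n i ≫ q) := by
  cases i using Fin.lastCases with
  | last =>
    rw [rotationData_δ_last, Category.assoc]
    exact (hq.rotation_comp h).comp (comulAt H (n + 1) 0) (diagPow_comp_comulAt H (n + 1) 0)
  | cast i =>
    rw [rotationData_δ_castSucc]
    exact hq.comp (comulAt H (n + 1) i) (diagPow_comp_comulAt H (n + 1) i)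

end IsBalanced

end Symmetric

end Powers

section ConnesMoscovici

variable {C : Type u} [Category.{v} C] [MonoidalCategory C]

section Braided

variable [BraidedCategory C] {H : C} [HopfObj H] {δ : H ⟶ 𝟙_ C} {σ : 𝟙_ C ⟶ H}

theorem consUnit_comp_whiskerLeft {m n : ℕ} (f : pow H m ⟶ pow H n) :
    consUnit H m ≫ H ◁ f = f ≫ consUnit H n :=
  includeRight_comp_whiskerLeft f

theorem consUnit_comp_comulAt_zero (n : ℕ) :
    consUnit H n ≫ comulAt H (n + 1) 0 = consUnit H n ≫ consUnit H (n + 1) := by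
  have one_comul : η[H] ▷ pow H n ≫ Δ[H] ▷ pow H n =
      (λ_ (𝟙_ C)).inv ▷ pow H n ≫ (η[H] ⊗ₘ η[H]) ▷ pow H n := by
    rw [← comp_whiskerRight, Bimon.one_comul, comp_whiskerRight]
  have split_unit : (λ_ (𝟙_ C)).inv ▷ pow H n =
      (λ_ (𝟙_ C ⊗ pow H n)).inv ≫ (α_ (𝟙_ C) (𝟙_ C) (pow H n)).inv := by
    simp
  rw [consUnit, consUnit, comulAt_zero, Category.assoc, Category.assoc, reassoc_of% one_comul,
    split_unit, ← tensorHom_id, ← tensorHom_id, associator_naturality, Category.assoc,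
    Iso.inv_hom_id_assoc, MonoidalCategory.tensorHom_def', tensorHom_id,
    ← leftUnitor_inv_naturality_assoc]

theorem consUnit_comp_rotation (σ : 𝟙_ C ⟶ H) (n : ℕ) :
    consUnit H n ≫ rotation (mulLeft σ) n = snocMap σ n := by
  rw [consUnit, rotation, snocMap, Category.assoc, ← comp_whiskerRight_assoc, one_comp_mulLeft,
    BraidedCategory.braiding_naturality_left_assoc, leftUnitor_inv_braiding_assoc]

theorem snocMap_comp_powRetraction (h : IsBraidedMPI δ σ) (n : ℕ) :
    snocMap σ n ≫ powRetraction δ n = cmTau δ σ n := by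
  cases n with
  | zero =>
    change ((ρ_ (𝟙_ C)).inv ≫ 𝟙_ C ◁ σ ≫ (λ_ H).hom ≫ (ρ_ H).inv) ≫
      (twistedAntipode δ ≫ ε[H]) ▷ 𝟙_ C ≫ (λ_ (𝟙_ C)).hom = 𝟙 (𝟙_ C)
    rw [twistedAntipode_comp_counit]
    simp [unitors_equal, h.modular]
  | succ n =>
    rw [snocMap_succ, cmTau, comulPow_eq_diagPow, mulPow_eq_mul, powRetraction, retraction,
      MonoidalCategory.tensorHom_def', Category.assoc]

theorem cmData_δ_last (n : ℕ) : (cmData δ σ).δ n (Fin.last n).succ = snocMap σ n := by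
  simp only [cmData, Fin.cases_succ, Fin.lastCases_last]

theorem cmData_δ_castSucc_succ (n : ℕ) (i : Fin n) :
    (cmData δ σ).δ n i.castSucc.succ = comulAt H n i := by
  simp only [cmData, Fin.cases_succ, Fin.lastCases_castSucc]

theorem IsBalanced.powRetraction_comp_eq (hδ : IsCharacter δ) {m n : ℕ}
    {f : pow H (m + 1) ⟶ pow H (n + 1)} (hf : IsBalanced δ (f ≫ powRetraction δ n))
    {g : pow H m ⟶ pow H n} (hfg : consUnit H m ≫ f = g ≫ consUnit H n) :
    powRetraction δ m ≫ g = f ≫ powRetraction δ n := by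
  rw [← hf.powRetraction_comp, reassoc_of% hfg, consUnit_comp_powRetraction hδ, Category.comp_id]

end Braided

variable [SymmetricCategory C] {H : C} [HopfObj H] {δ : H ⟶ 𝟙_ C} {σ : 𝟙_ C ⟶ H}

theorem consUnit_comp_rotationData_δ (n : ℕ) (i : Fin (n + 2)) :
    consUnit H n ≫ (rotationData (mulLeft σ)).δ n i =
      (cmData δ σ).δ n i ≫ consUnit H (n + 1) := by
  cases i using Fin.cases with
  | zero =>
    rw [rotationData_δ_zero]
    exact consUnit_comp_comulAt_zero n
  | succ i =>
    cases i using Fin.lastCases with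
    | last =>
      rw [cmData_δ_last, Fin.succ_last, rotationData_δ_last,
        reassoc_of% consUnit_comp_comulAt_zero n, consUnit_comp_rotation, snocMap_succ]
      exact consUnit_comp_whiskerLeft (snocMap σ n)
    | cast i =>
      rw [cmData_δ_castSucc_succ, Fin.succ_castSucc, rotationData_δ_castSucc]
      exact consUnit_comp_whiskerLeft (comulAt H n i)

theorem consUnit_comp_rotationData_σ (n : ℕ) (i : Fin (n + 1)) :
    consUnit H (n + 1) ≫ (rotationData (mulLeft σ)).σ n i =
      (cmData δ σ).σ n i ≫ consUnit H n :=
  consUnit_comp_whiskerLeft (counitAt H n i)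

namespace IsBraidedMPI

/-- The retractions `H^{⊗ (n+1)} ⟶ H^{⊗ n}` as a map from the para-cocyclic object of the
coalgebra `H`, rotated by left multiplication by `σ`, to the Connes–Moscovici object. -/
def powRetractionHom (h : IsBraidedMPI δ σ) :
    (rotationData (mulLeft σ)).Hom (cmData δ σ) where
  app n := powRetraction δ n
  app_comp_δ n i :=
    ((isBalanced_powRetraction h.character (n + 1)).rotationData_δ_comp h i).powRetraction_comp_eq
      (n := n + 1) h.character (consUnit_comp_rotationData_δ n i)
  app_comp_σ n i :=
    ((isBalanced_powRetraction h.character n).rotationData_σ_comp i).powRetraction_comp_eq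
      h.character (consUnit_comp_rotationData_σ n i)
  app_comp_τ n :=
    calc powRetraction δ n ≫ cmTau δ σ n
      _ = powRetraction δ n ≫ consUnit H n ≫ rotation (mulLeft σ) n ≫ powRetraction δ n := by
        rw [← snocMap_comp_powRetraction h, ← consUnit_comp_rotation, Category.assoc]
      _ = rotation (mulLeft σ) n ≫ powRetraction δ n :=
        ((isBalanced_powRetraction h.character n).rotation_comp h).powRetraction_comp

theorem isCocyclic_cmData (h : IsBraidedMPI δ σ) : (cmData δ σ).IsCocyclic := by
  have epi (n : ℕ) : Epi (h.powRetractionHom.app n) :=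
    (SplitEpi.mk (consUnit H n) (consUnit_comp_powRetraction h.character n)).epi
  refine (isParacocyclic_rotationData (mulLeft_comp_comul h.cocharacter)
    (mulLeft_comp_counit h.cocharacter)).isCocyclic_of_epi h.powRetractionHom fun n ↦ ?_
  rw [endPow_rotation]
  exact (isBalanced_powRetraction h.character n).powMap_mulLeft_comp h.cocharacter h.modular

end IsBraidedMPI

end ConnesMoscovici

section ModuleConditions

variable {C : Type u} [Category.{v} C] [MonoidalCategory C]

section Braided

variable [BraidedCategory C] {H : C} [HopfObj H] {δ : H ⟶ 𝟙_ C} {σ : 𝟙_ C ⟶ H}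

theorem isModuleCoalgebra_regular (H : C) [HopfObj H] : IsModuleCoalgebra (ModObj.regular H) where
  act_comul := BimonObj.mul_comul H
  act_counit := Bimon.mul_counit H

theorem twistedAntipode_eq_comul_braiding (δ : H ⟶ 𝟙_ C) :
    twistedAntipode δ = Δ[H] ≫ (β_ H H).hom ≫ H ◁ δ ≫ 𝒮[H] ▷ 𝟙_ C ≫ (ρ_ H).hom := by
  rw [twistedAntipode, ← MonoidalCategory.tensorHom_def'_assoc,
    ← BraidedCategory.braiding_naturality_assoc, braiding_rightUnitor]

namespace IsBraidedMPI

theorem mul_comul_twistedAntipode_braiding (h : IsBraidedMPI δ σ) :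
    (λ_ H).inv ≫ σ ▷ H ≫ H ◁ Δ[H] ≫ (α_ H H H).inv ≫
      (H ⊗ H) ◁ twistedAntipode δ ≫ μ[H] ▷ H ≫ (β_ H H).hom ≫ μ[H] = δ ≫ σ := by
  have mulLeft_whiskerRight : mulLeft σ ▷ H =
      (λ_ (H ⊗ H)).inv ≫ σ ▷ (H ⊗ H) ≫ (α_ H H H).inv ≫ μ[H] ▷ H := by
    simp [mulLeft]
  rw [← h.comul_braiding_twistedAntipode_mulLeft, ← BraidedCategory.braiding_naturality_assoc,
    MonoidalCategory.tensorHom_def, Category.assoc, mulLeft_whiskerRight, Category.assoc,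
    Category.assoc, Category.assoc, leftUnitor_inv_naturality_assoc, whisker_exchange_assoc,
    whisker_exchange_assoc]

theorem isSAYD (h : IsBraidedMPI δ σ) :
    IsSAYD (characterModule h.character) (cocharacterComodule h.cocharacter) where
  ayd := by
    have braiding_antipode : (β_ (H ⊗ H) H).hom ≫ (𝒮[H] ⊗ₘ μ[H]) =
        (H ⊗ H) ◁ 𝒮[H] ≫ μ[H] ▷ H ≫ (β_ H H).hom := by
      rw [← BraidedCategory.braiding_naturality, MonoidalCategory.tensorHom_def', Category.assoc]
    have exchange_δ {X Y Z : C} (f : X ⟶ Y) (g : Y ⟶ Z) :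
        f ▷ H ≫ g ▷ H ≫ Z ◁ δ = X ◁ δ ≫ f ▷ 𝟙_ C ≫ g ▷ 𝟙_ C := by
      rw [← whisker_exchange, ← whisker_exchange_assoc]
    have act_coact : (characterModule h.character).act ≫ (cocharacterComodule h.cocharacter).coact =
        (λ_ H).hom ≫ (δ ≫ σ) ≫ (ρ_ H).inv := by
      simp [cocharacterComodule, characterModule]
    calc (characterModule h.character).act ≫ (cocharacterComodule h.cocharacter).coact
      _ = (λ_ H).hom ≫ ((λ_ H).inv ≫ σ ▷ H ≫ H ◁ Δ[H] ≫ H ◁ H ◁ Δ[H] ≫ H ◁ H ◁ (β_ H H).hom) ⊗≫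
          ((β_ (H ⊗ H) H).hom ≫ (𝒮[H] ⊗ₘ μ[H])) ▷ H ≫ μ[H] ▷ H ≫ H ◁ δ ≫ (ρ_ H).hom ≫
            (ρ_ H).inv := by
        rw [act_coact, ← h.mul_comul_twistedAntipode_braiding, twistedAntipode_eq_comul_braiding,
          braiding_antipode, reassoc_of% exchange_δ]
        monoidal
      _ = _ := by
        simp only [cocharacterComodule, characterModule, braiding_tensorUnit_left,
          MonoidalCategory.tensorHom_def]
        monoidal
  stable := by
    change (σ ≫ (ρ_ H).inv) ≫ (β_ H (𝟙_ C)).hom ≫ (λ_ H).hom ≫ δ = 𝟙 (𝟙_ C)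
    rw [braiding_tensorUnit_right]
    simp [h.modular]

end IsBraidedMPI

theorem diagAct_regular (n : ℕ) :
    diagAct (ModObj.regular H) n = diagPow H (n + 1) ▷ pow H (n + 1) ≫ μ[pow H (n + 1)] := by
  rw [← mulPow_eq_mul, ← comulPow_eq_diagPow]
  rfl

theorem coact_comp_rotate (hσ : IsCocharacter σ) (n : ℕ) :
    (cocharacterComodule hσ).coact ▷ pow H (n + 1) ≫ rotate (ModObj.regular H) (𝟙_ C) n =
      𝟙_ C ◁ rotation (mulLeft σ) n := by
  change (σ ≫ (ρ_ H).inv) ▷ (H ⊗ pow H n) ≫ (β_ H (𝟙_ C)).hom ▷ (H ⊗ pow H n) ≫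
    (α_ (𝟙_ C) H (H ⊗ pow H n)).hom ≫ 𝟙_ C ◁ ((α_ H H (pow H n)).inv ≫ μ[H] ▷ pow H n ≫
      (β_ H (pow H n)).hom ≫ (powSnoc H n).hom) = _
  rw [braiding_tensorUnit_right, rotation, mulLeft]
  monoidal

end Braided

variable [SymmetricCategory C] {H : C} [HopfObj H] {σ : 𝟙_ C ⟶ H}

theorem tripleData_τ (hσ : IsCocharacter σ) (n : ℕ) :
    (tripleData (ModObj.regular H) (cocharacterComodule hσ)).τ n =
      𝟙_ C ◁ (rotationData (mulLeft σ)).τ n :=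
  coact_comp_rotate hσ n

theorem tripleData_σ (hσ : IsCocharacter σ) (n : ℕ) (i : Fin (n + 1)) :
    (tripleData (ModObj.regular H) (cocharacterComodule hσ)).σ n i =
      𝟙_ C ◁ (rotationData (mulLeft σ)).σ n i :=
  rfl

theorem tripleData_δ (hσ : IsCocharacter σ) (n : ℕ) (i : Fin (n + 2)) :
    (tripleData (ModObj.regular H) (cocharacterComodule hσ)).δ n i =
      𝟙_ C ◁ (rotationData (mulLeft σ)).δ n i := by
  cases i using Fin.lastCases with
  | last =>
    have δ_last : (tripleData (ModObj.regular H) (cocharacterComodule hσ)).δ n (Fin.last (n + 1)) =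
        ((cocharacterComodule hσ).coact ⊗ₘ comulAt H (n + 1) 0) ≫
          rotate (ModObj.regular H) (𝟙_ C) (n + 1) := by
      simp only [tripleData, Fin.lastCases_last]
    rw [rotationData_δ_last, δ_last, MonoidalCategory.tensorHom_def', Category.assoc,
      coact_comp_rotate hσ]
    exact (whiskerLeft_comp _ _ _).symm
  | cast i =>
    rw [rotationData_δ_castSucc]
    simp only [tripleData, Fin.lastCases_castSucc]

end ModuleConditions

section Abelian

variable {C : Type u} [Category.{v} C] [Abelian C] [MonoidalCategory C]

section Braided

instance epi_balancedProj [BraidedCategory C] {H K M : C} [HopfObj H] (b : ModObj H K)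
    (a : RightModule H M) (n : ℕ) : Epi (balancedProj b a n) :=
  inferInstanceAs (Epi (cokernel.π _))

variable [BraidedCategory C] {H B : C} [HopfObj H] {δ : H ⟶ 𝟙_ C}

theorem balancedMap_comp_eq_zero_iff (hδ : IsCharacter δ) {n : ℕ} (q : pow H (n + 1) ⟶ B) :
    balancedMap (ModObj.regular H) (characterModule hδ) n ≫ (λ_ (pow H (n + 1))).hom ≫ q = 0 ↔
      IsBalanced δ q := by
  have act_comp : (characterModule hδ).act ▷ pow H (n + 1) ≫ (λ_ (pow H (n + 1))).hom ≫ q =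
      (λ_ H).hom ▷ pow H (n + 1) ≫ (δ ≫ η[pow H (n + 1)]) ▷ pow H (n + 1) ≫
        μ[pow H (n + 1)] ≫ q := by
    rw [comp_whiskerRight δ, Category.assoc, MonObj.one_mul_assoc, ← comp_whiskerRight_assoc]
    rfl
  have diagAct_comp : ((α_ (𝟙_ C) H (pow H (n + 1))).hom ≫ 𝟙_ C ◁ diagAct (ModObj.regular H) n) ≫
      (λ_ (pow H (n + 1))).hom ≫ q =
        (λ_ H).hom ▷ pow H (n + 1) ≫ diagPow H (n + 1) ▷ pow H (n + 1) ≫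
          μ[pow H (n + 1)] ≫ q := by
    rw [Category.assoc, leftUnitor_naturality_assoc, diagAct_regular, Category.assoc,
      leftUnitor_tensor_hom_assoc, Iso.hom_inv_id_assoc]
  rw [balancedMap, Preadditive.sub_comp, sub_eq_zero, act_comp, diagAct_comp, cancel_epi,
    IsBalanced, CoequalizesMul, eq_comm]

theorem isBalanced_balancedProj (hδ : IsCharacter δ) (n : ℕ) :
    IsBalanced δ ((λ_ (pow H (n + 1))).inv ≫
      balancedProj (ModObj.regular H) (characterModule hδ) n) := by
  rw [← balancedMap_comp_eq_zero_iff hδ, Iso.hom_inv_id_assoc]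
  exact cokernel.condition _

/-- The morphism out of `^σI_δ ⊗_H H^{⊗ (n+1)}` induced by a balanced morphism. -/
def IsBalanced.desc (hδ : IsCharacter δ) {n : ℕ} {q : pow H (n + 1) ⟶ B} (hq : IsBalanced δ q) :
    balanced (ModObj.regular H) (characterModule hδ) n ⟶ B :=
  cokernel.desc _ ((λ_ (pow H (n + 1))).hom ≫ q) ((balancedMap_comp_eq_zero_iff hδ q).2 hq)

theorem IsBalanced.balancedProj_comp_desc (hδ : IsCharacter δ) {n : ℕ} {q : pow H (n + 1) ⟶ B}
    (hq : IsBalanced δ q) :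
    balancedProj (ModObj.regular H) (characterModule hδ) n ≫ hq.desc hδ =
      (λ_ (pow H (n + 1))).hom ≫ q :=
  cokernel.π_desc _ _ _

/-- The isomorphism `^σI_δ ⊗_H H^{⊗ (n+1)} ≅ H^{⊗ n}` induced by `powRetraction δ n`. -/
def balancedIso (hδ : IsCharacter δ) (n : ℕ) :
    balanced (ModObj.regular H) (characterModule hδ) n ≅ pow H n where
  hom := (isBalanced_powRetraction hδ n).desc hδ
  inv := consUnit H n ≫ (λ_ (pow H (n + 1))).inv ≫
    balancedProj (ModObj.regular H) (characterModule hδ) n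
  hom_inv_id := by
    rw [← cancel_epi (balancedProj (ModObj.regular H) (characterModule hδ) n),
      reassoc_of% (isBalanced_powRetraction hδ n).balancedProj_comp_desc hδ,
      (isBalanced_balancedProj hδ n).powRetraction_comp, Iso.hom_inv_id_assoc, Category.comp_id]
  inv_hom_id := by
    rw [Category.assoc, Category.assoc, IsBalanced.balancedProj_comp_desc, Iso.inv_hom_id_assoc,
      consUnit_comp_powRetraction hδ]

theorem balancedProj_comp_balancedIso_hom (hδ : IsCharacter δ) (n : ℕ) :
    balancedProj (ModObj.regular H) (characterModule hδ) n ≫ (balancedIso hδ n).hom =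
      (λ_ (pow H (n + 1))).hom ≫ powRetraction δ n :=
  (isBalanced_powRetraction hδ n).balancedProj_comp_desc hδ

theorem balancedProj_comp_conj (hδ : IsCharacter δ) {m n : ℕ}
    {f : pow H (m + 1) ⟶ pow H (n + 1)} {g : pow H m ⟶ pow H n}
    (hfg : powRetraction δ m ≫ g = f ≫ powRetraction δ n) :
    balancedProj (ModObj.regular H) (characterModule hδ) m ≫
        (balancedIso hδ m).hom ≫ g ≫ (balancedIso hδ n).inv =
      𝟙_ C ◁ f ≫ balancedProj (ModObj.regular H) (characterModule hδ) n := by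
  rw [reassoc_of% balancedProj_comp_balancedIso_hom hδ m, reassoc_of% hfg,
    ← leftUnitor_naturality_assoc, ← reassoc_of% balancedProj_comp_balancedIso_hom hδ n,
    Iso.hom_inv_id, Category.comp_id]

end Braided

variable [SymmetricCategory C] {H : C} [HopfObj H] {δ : H ⟶ 𝟙_ C} {σ : 𝟙_ C ⟶ H}

namespace IsBraidedMPI

/-- The structure maps on `^σI_δ ⊗_H H^{⊗ (n+1)}`, obtained by transporting the Connes–Moscovici
ones along `balancedIso`. -/
def inducedMaps (h : IsBraidedMPI δ σ) : InducedMaps (ModObj.regular H)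
    (characterModule h.character) (cocharacterComodule h.cocharacter) where
  δ n i := (balancedIso h.character n).hom ≫ (cmData δ σ).δ n i ≫
    (balancedIso h.character (n + 1)).inv
  σ n i := (balancedIso h.character (n + 1)).hom ≫ (cmData δ σ).σ n i ≫
    (balancedIso h.character n).inv
  τ n := (balancedIso h.character n).hom ≫ (cmData δ σ).τ n ≫ (balancedIso h.character n).inv
  proj_δ n i := by
    rw [tripleData_δ]
    exact balancedProj_comp_conj h.character (h.powRetractionHom.app_comp_δ n i)
  proj_σ n i := by
    rw [tripleData_σ]
    exact balancedProj_comp_conj h.character (h.powRetractionHom.app_comp_σ n i)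
  proj_τ n := by
    rw [tripleData_τ]
    exact balancedProj_comp_conj h.character (h.powRetractionHom.app_comp_τ n)

/-- The isomorphism of `^σI_δ ⊗_H H^{⊗ (n+1)}`, with the induced structure maps, with the
Connes–Moscovici object. -/
def inducedMapsIso (h : IsBraidedMPI δ σ) : h.inducedMaps.toCocyclicData.Iso (cmData δ σ) where
  iso := balancedIso h.character
  comm_δ n _ :=
    (balancedIso h.character (n + 1)).eq_comp_inv.1 (Category.assoc _ _ _).symm
  comm_σ n _ := (balancedIso h.character n).eq_comp_inv.1 (Category.assoc _ _ _).symm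
  comm_τ n := (balancedIso h.character n).eq_comp_inv.1 (Category.assoc _ _ _).symm

end IsBraidedMPI

end Abelian

end

end BraidedHopfCyclic

theorem mainTheorem3 {C : Type u} [Category.{v} C] [Abelian C] [MonoidalCategory C]
    [SymmetricCategory C] (H : C) [HopfObj H] (δ : H ⟶ 𝟙_ C) (σ : 𝟙_ C ⟶ H)
    (h : BraidedHopfCyclic.IsBraidedMPI δ σ) :
    BraidedHopfCyclic.IsModuleCoalgebra (ModObj.regular H) ∧
    BraidedHopfCyclic.IsSAYD (BraidedHopfCyclic.characterModule h.character)
      (BraidedHopfCyclic.cocharacterComodule h.cocharacter) ∧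
    (BraidedHopfCyclic.cmData δ σ).IsCocyclic ∧
    ∃ T : BraidedHopfCyclic.InducedMaps (ModObj.regular H)
        (BraidedHopfCyclic.characterModule h.character)
        (BraidedHopfCyclic.cocharacterComodule h.cocharacter),
      T.toCocyclicData.IsCocyclic ∧
      Nonempty (T.toCocyclicData.Iso (BraidedHopfCyclic.cmData δ σ)) :=
  ⟨BraidedHopfCyclic.isModuleCoalgebra_regular H, h.isSAYD, h.isCocyclic_cmData, h.inducedMaps,
    h.inducedMapsIso.isCocyclic h.isCocyclic_cmData, ⟨h.inducedMapsIso⟩⟩
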